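/- Let $F_4=\{0,1,w,w^2\}$ with $w^2+w+1=0$. An additive $[n,\frac k2,d]_4$ code is an additive subgroup of $F_4^n$ with $2^k=4^{k/2}$ elements whose minimum nonzero Hamming weight is $d$. Its weight distribution is $1+\sum_{i=1}^n A_iz^i$, where $A_i$ is the number of codewords of weight $i$; it is a $t$-weight code if exactly $t$ of $A_1,\dots,A_n$ are nonzero. The additive code generated by a matrix over $F_4$ is the additive group generated by its rows. The generator multiset of a matrix is the multiset of its columns, and a multiset of columns generates the code of any matrix having these columns (determined up to a permutation of coordinates). Two codes are called equivalent if they agree up to a permutation of coordinates. Put $g(m,\delta)=\sum_{i=0}^{m-1}\lceil \delta/2^i\rceil$. An additive $[n,\frac k2,d]_4$ code is a Griesmer code if $3n=g(k,2d)$, and it is Griesmer puncture-optimal (GPO) if $3n+3<g(k,2d+2)$, so that there is no additive code of length $n+1$, with $2^k$ elements and minimum distance at least $d+1$. Let $k=k_1+k_2$ with $k_1\ge 3$ odd and $k_2=2l\ge 4$ even. Define generator matrices as follows. * Let $f=x^3+f_2x^2+f_1x+f_0\in F_2[x]$ be irreducible, and let $S$ be a $3\times 7$ binary matrix with rows $r_0,r_1,r_2$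 whose columns are the $7$ nonzero vectors of $F_2^3$. Let $A_{3/2}$ be the $3\times 7$ matrix with rows $r_0+wr_1$, $r_1+wr_2$, $r_2+w(f_0r_0+f_1r_1+f_2r_2)$. For odd $m\ge 3$, let $A_{m/2+1}$ be the $(m+2)\times(2^{m+2}-1)$ matrix whose columns are $(\alpha,\beta,w\beta)^T$ for all columns $\alpha$ of $A_{m/2}$ and all $\beta\in F_4$, and $(0,\beta,w\beta)^T$ for all $\beta\in F_4\setminus\{0\}$. This defines $A_{k_1/2}$. * Let $G$ be an $l\times\frac{4^l-1}{3}$ matrix over $F_4$ whose columns represent each one-dimensional subspace of $F_4^l$ exactly once, and let $$A_{k_2/2}=\begin{pmatrix}G& wG& w^2G\\ wG& w^2G& G\end{pmatrix}.$$ * For matrices $A,B$, let $A\star B$ be the matrix whose columns are all $\binom{\alpha}{\beta}$ with $\alpha$ a column of $A$ and $\beta$ a column of $B$. Let $\mathcal L$, $\mathcal L_1$, $\mathcal L_2$ be the generator multisets of $$\left(A_{k_1/2}\star A_{k_2/2}\ \Big|\ \begin{matrix}A_{k_1/2}&0\\0&A_{k_2/2}\end{matrix}\right),\qquad \begin{pmatrix}A_{k_1/2}\\0\end{pmatrix},\qquad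 \begin{pmatrix}0\\A_{k_2/2}\end{pmatrix},$$ respectively. Then the following hold. (1) $\mathcal L\setminus\mathcal L_1$ can be divided into three parts that generate pairwise equivalent codes, and each part generates an additive two-weight $\left[\frac{2^k-2^{k_1}}3,\frac k2,2^{k-2}-2^{k_1-2}\right]_4$ code with weight distribution $$1+(2^k-2^{k_2})z^{2^{k-2}-2^{k_1-2}}+(2^{k_2}-1)z^{2^{k-2}}.$$ (2) $\mathcal L\setminus(\mathcal L_1+\mathcal L_2)$ can be divided into three parts that generate pairwise equivalent codes, and each part generates an additive three-weight $\left[\frac{2^k-2^{k_1}-2^{k_2}+1}3,\frac k2,2^{k-2}-2^{k_1-2}-2^{k_2-2}\right]_4$ code with weight distribution $$1+(2^k-2^{k_1}-2^{k_2}+1)z^{2^{k-2}-2^{k_1-2}-2^{k_2-2}}+(2^{k_1}-1)z^{2^{k-2}-2^{k_1-2}}+(2^{k_2}-1)z^{2^{k-2}-2^{k_2-2}}.$$ (3) All codes in (1) and (2) are both GPO and Griesmer codes. -/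

import Mathlib

open Polynomial

namespace QuaternaryAdditive

/-- The field with four elements. -/
abbrev F4 : Type := GaloisField 2 2

noncomputable instance instDecidableEqF4 : DecidableEq F4 := Classical.decEq F4

noncomputable instance instFintypeF4 : Fintype F4 := Fintype.ofFinite F4

/-! ### Additive codes -/

/-- The additive code generated by the rows of a matrix over the field with four elements. -/
noncomputable def codeOf {R : Type} {n : ℕ} (A : Matrix R (Fin n) F4) : AddSubgroup (Fin n → F4) :=
  AddSubgroup.closure (Set.range fun r => A r)

/-- `C` is an additive `[n, k/2, d]` code over the field with four elements: an additive subgroup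
with `2 ^ k = 4 ^ (k/2)` elements and minimum nonzero Hamming weight `d`. Here `k` is twice the
dimension. -/
structure IsAdditiveCode (n k d : ℕ) (C : AddSubgroup (Fin n → F4)) : Prop where
  card_eq : Nat.card C = 2 ^ k
  isLeast_weight : IsLeast {m : ℕ | ∃ c ∈ C, c ≠ 0 ∧ hammingNorm c = m} d

/-- The number of codewords of weight `i`. -/
noncomputable def weightCount {n : ℕ} (C : AddSubgroup (Fin n → F4)) (i : ℕ) : ℕ :=
  {c : Fin n → F4 | c ∈ C ∧ hammingNorm c = i}.ncard

/-- The weight distribution `1 + A₁ z + ⋯ + Aₙ zⁿ`. -/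
noncomputable def weightDistribution {n : ℕ} (C : AddSubgroup (Fin n → F4)) : ℤ[X] :=
  1 + ∑ i ∈ Finset.Icc 1 n, (weightCount C i : ℤ[X]) * X ^ i

/-- A `t`-weight code: exactly `t` of the numbers `A₁, …, Aₙ` are nonzero. -/
def IsTWeight {n : ℕ} (t : ℕ) (C : AddSubgroup (Fin n → F4)) : Prop :=
  ((Finset.Icc 1 n).filter fun i => weightCount C i ≠ 0).card = t

/-- Two codes are equivalent: they agree after a permutation of the coordinates (no rescaling of
coordinates and no conjugation is needed). -/
def Equivalent {n : ℕ} (C D : AddSubgroup (Fin n → F4)) : Prop :=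
  ∃ e : Equiv.Perm (Fin n), ∀ c : Fin n → F4, c ∈ D ↔ c ∘ e ∈ C

/-- `g(m, δ) = ∑_{i=0}^{m-1} ⌈δ / 2^i⌉`. -/
noncomputable def griesmerSum (m δ : ℕ) : ℕ :=
  ∑ i ∈ Finset.range m, ⌈(δ : ℚ) / 2 ^ i⌉₊

/-- An additive `[n, k/2, d]` code meeting the additive Griesmer bound `3 n ≥ g(k, 2 d)` with
equality. -/
def IsGriesmerCode (n k d : ℕ) (C : AddSubgroup (Fin n → F4)) : Prop :=
  IsAdditiveCode n k d C ∧ 3 * n = griesmerSum k (2 * d)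

/-- An additive Griesmer puncture-optimal `[n, k/2, d]` code: `3 n + 3 < g(k, 2 d + 2)`, so that
there is no additive code of length `n + 1`, the same dimension and minimum distance at least
`d + 1`. -/
structure IsGPO (n k d : ℕ) (C : AddSubgroup (Fin n → F4)) : Prop where
  isCode : IsAdditiveCode n k d C
  lt_griesmerSum : 3 * n + 3 < griesmerSum k (2 * d + 2)
  not_exists : ¬ ∃ (d' : ℕ) (D : AddSubgroup (Fin (n + 1) → F4)),
    d + 1 ≤ d' ∧ IsAdditiveCode (n + 1) k d' D

/-! ### Generator matrices and generator multisets -/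

/-- The generator multiset of a matrix: the multiset of its columns. -/
noncomputable def columns {R ι : Type} [Fintype ι] (A : Matrix R ι F4) : Multiset (R → F4) :=
  Finset.univ.val.map fun j => fun r => A r j

/-- A generator matrix of the simplex code over `F`: the columns are nonzero and contain exactly
one representative of each one-dimensional subspace. -/
structure IsSimplexGenerator {F R ι : Type} [Field F] (G : Matrix R ι F) : Prop where
  col_ne_zero : ∀ j, (fun r => G r j) ≠ 0
  existsUnique : ∀ v : R → F, v ≠ 0 → ∃! j, ∃ a : F, a ≠ 0 ∧ v = fun r => a * G r j

/-- The matrix with rows `r₀ + w r₁, …, r_{k-2} + w r_{k-1}, r_{k-1} + w ∑ i, f_i r_i`, where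
`r₀, …, r_{k-1}` are the rows of the binary matrix `S`. -/
noncomputable def apsMatrix {k n : ℕ} (w : F4) (f : (ZMod 2)[X])
    (S : Matrix (Fin k) (Fin n) (ZMod 2)) : Matrix (Fin k) (Fin n) F4 :=
  fun i j => algebraMap (ZMod 2) F4 (S i j) +
    w * algebraMap (ZMod 2) F4
      (if h : i.val + 1 < k then S ⟨i.val + 1, h⟩ j else ∑ m : Fin k, f.coeff m * S m j)

/-- One step of the iteration. Its columns are `(α, β, w β)` for all columns `α` of `A` and all `β`
in the field with four elements, and `(0, β, w β)` for all nonzero `β`. -/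
noncomputable def iterStep {R ι : Type} (w : F4) (A : Matrix R ι F4) :
    Matrix (R ⊕ Fin 2) ((ι × F4) ⊕ {β : F4 // β ≠ 0}) F4 :=
  Matrix.fromBlocks
    (fun r c => A r c.1) 0
    (fun i c => ![c.2, w * c.2] i) (fun i β => ![β.1, w * β.1] i)

/-- Row index of the `s`-fold iterated matrix: `2 s + 3` rows. -/
def IterRows : ℕ → Type
  | 0 => Fin 3
  | s + 1 => IterRows s ⊕ Fin 2

/-- Column index of the `s`-fold iterated matrix: `2 ^ (2 s + 3) - 1` columns. -/
def IterCols : ℕ → Type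
  | 0 => Fin 7
  | s + 1 => (IterCols s × F4) ⊕ {β : F4 // β ≠ 0}

noncomputable instance instFintypeIterCols : (s : ℕ) → Fintype (IterCols s)
  | 0 => inferInstanceAs (Fintype (Fin 7))
  | s + 1 =>
    letI := instFintypeIterCols s
    inferInstanceAs (Fintype ((IterCols s × F4) ⊕ {β : F4 // β ≠ 0}))

/-- The `s`-fold iteration starting from a `3 × 7` matrix. -/
noncomputable def iterMatrix (w : F4) (A : Matrix (Fin 3) (Fin 7) F4) :
    (s : ℕ) → Matrix (IterRows s) (IterCols s) F4
  | 0 => A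
  | s + 1 => iterStep w (iterMatrix w A s)

/-- The matrix with block rows `(G, w G, w² G)` and `(w G, w² G, G)`. -/
noncomputable def dividedSimplex {R ι : Type} (w : F4) (G : Matrix R ι F4) :
    Matrix (R ⊕ R) (ι ⊕ (ι ⊕ ι)) F4 :=
  Matrix.fromRows
    (Matrix.fromCols G (Matrix.fromCols (w • G) (w ^ 2 • G)))
    (Matrix.fromCols (w • G) (Matrix.fromCols (w ^ 2 • G) G))

/-- `A ⋆ B`: the columns are all `(α, β)` with `α` a column of `A` and `β` a column of `B`. -/
noncomputable def starProd {R₁ R₂ ι₁ ι₂ : Type} (A : Matrix R₁ ι₁ F4) (B : Matrix R₂ ι₂ F4) :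
    Matrix (R₁ ⊕ R₂) (ι₁ × ι₂) F4 :=
  Matrix.fromRows (fun r c => A r c.1) (fun r c => B r c.2)

/-- The matrix `(A ⋆ B | (A; 0) | (0; B))`. -/
noncomputable def combine {R₁ R₂ ι₁ ι₂ : Type} (A : Matrix R₁ ι₁ F4) (B : Matrix R₂ ι₂ F4) :
    Matrix (R₁ ⊕ R₂) ((ι₁ × ι₂) ⊕ (ι₁ ⊕ ι₂)) F4 :=
  Matrix.fromCols (starProd A B) (Matrix.fromBlocks A 0 0 B)

/-- The matrix `(A; 0)`. -/
noncomputable def padBelow {R₁ ι : Type} (R₂ : Type) (A : Matrix R₁ ι F4) : Matrix (R₁ ⊕ R₂) ι F4 :=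
  Matrix.fromRows A 0

/-- The matrix `(0; B)`. -/
noncomputable def padAbove {R₂ ι : Type} (R₁ : Type) (B : Matrix R₂ ι F4) : Matrix (R₁ ⊕ R₂) ι F4 :=
  Matrix.fromRows 0 B

/-- Multiset difference of generator multisets. -/
noncomputable def msDiff {V : Type} (L M : Multiset V) : Multiset V :=
  letI := Classical.decEq V
  L - M

end QuaternaryAdditive

open QuaternaryAdditive

/-!
A column `x + w x'` with binary vectors `x`, `x'` stands for the line through the points `x` and
`x'` of a binary projective space, and a codeword is given by a linear functional, evaluated at
`x` and `x'`; a coordinate vanishes exactly when the line lies in the kernel of the functional.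

For all matrices involved, the columns are the vectors `x + w T x` for the nonzero binary vectors
`x`, with `T` linear and both `T` and `T + 1` injective: on the first block `T` is multiplication
by a root of `f` extended by multiplications by `w` (`exists_isOrthomorphism_iterMatrix`), and on
the second block it is multiplication by `w` (`columns_dividedSimplex`). The combined multiset
consists of the lines `{x, T x, x + T x}` for `x = (y, z) ≠ 0`, and removing the padded blocks
removes the lines with `z = 0`, or those with `y = 0` or `z = 0`.

Since `z, w z, w² z` for the columns `z` of `G` run through all nonzero vectors, one third of the
remaining lines, those with `z` in `w ^ j G`, are divided off for each `j`. Multiplication of `z`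
by `w` commutes with `T`, so the three parts generate the same code (`exists_three_parts`), and
the lines of one part partition the point set. A line not contained in a hyperplane has two points
outside it, so the weights of the code follow by counting points off a hyperplane
(`two_mul_hammingNorm_lineEval`, `two_mul_offCount_univ`, `two_mul_offCount_erase`).

Replacing each symbol by its images under the three nonzero binary functionals turns an additive
code into a binary linear code of triple length and double weights, so that the Griesmer bound,
proved by residual codes (`griesmerSum_le_card`), applies. The codes meet it with equality, and
since `4 ∣ 2 d`, the value `g(k, 2 d + 2)` exceeds `g(k, 2 d)` by at least four, which excludes
codes of length `n + 1` and distance `d + 1` (`isGPO_and_isGriesmerCode`).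
-/

/-! ### The Griesmer sum -/

theorem ceil_div_two_pow_le_iff (δ i c : ℕ) : ⌈(δ : ℚ) / 2 ^ i⌉₊ ≤ c ↔ δ ≤ c * 2 ^ i := by
  rw [Nat.ceil_le, div_le_iff₀ (by positivity)]
  exact_mod_cast Iff.rfl

theorem griesmerSum_succ (m δ : ℕ) :
    griesmerSum (m + 1) δ = δ + griesmerSum m ((δ + 1) / 2) := by
  unfold griesmerSum
  rw [Finset.sum_range_succ', add_comm]
  congr 1
  · simp
  · refine Finset.sum_congr rfl fun i _ => eq_of_forall_ge_iff fun c => ?_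
    rw [ceil_div_two_pow_le_iff, ceil_div_two_pow_le_iff, pow_succ, ← mul_assoc]
    omega

theorem griesmerSum_mono (m : ℕ) {δ δ' : ℕ} (h : δ ≤ δ') :
    griesmerSum m δ ≤ griesmerSum m δ' := by
  refine Finset.sum_le_sum fun i _ => Nat.ceil_mono ?_
  have : (δ : ℚ) ≤ δ' := by exact_mod_cast h
  gcongr

/-- When `4 ∣ δ`, raising `δ` by two raises the first three terms of the Griesmer sum by `2`, `1`
and `1`. -/
theorem griesmerSum_add_four_le {m δ : ℕ} (hm : 3 ≤ m) (hδ : 4 ∣ δ) :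
    griesmerSum m δ + 4 ≤ griesmerSum m (δ + 2) := by
  obtain ⟨r, rfl⟩ := Nat.exists_eq_add_of_le' hm
  obtain ⟨q, rfl⟩ := hδ
  simp only [griesmerSum_succ]
  have := griesmerSum_mono r (show ((((4 * q + 1) / 2 + 1) / 2 + 1) / 2) ≤
    ((((4 * q + 2 + 1) / 2 + 1) / 2 + 1) / 2) by omega)
  omega

theorem sum_two_pow_div_two_pow {a k : ℕ} (h : a < k) :
    ∑ i ∈ Finset.range k, 2 ^ a / 2 ^ i = 2 ^ (a + 1) - 1 := by
  induction a generalizing k with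
  | zero =>
    obtain ⟨k, rfl⟩ := Nat.exists_eq_add_of_lt h
    rw [Finset.sum_range_succ', Finset.sum_eq_zero]
    · simp
    · intro i _
      exact Nat.div_eq_of_lt (Nat.one_lt_two_pow (by omega))
  | succ a ih =>
    obtain ⟨k, rfl⟩ := Nat.exists_eq_add_of_lt (Nat.zero_lt_of_lt h)
    rw [Finset.sum_range_succ', pow_zero, Nat.div_one]
    have : ∀ i, 2 ^ (a + 1) / 2 ^ (i + 1) = 2 ^ a / 2 ^ i := fun i => by
      rw [pow_succ, pow_succ, Nat.mul_div_mul_right _ _ two_pos]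
    simp only [this]
    rw [ih (by omega), pow_succ 2 (a + 1)]
    have := Nat.one_le_two_pow (n := a + 1)
    omega

/-- The Griesmer sum of `2 ^ k - m` falls short of the full sum `2 ^ (k + 1) - 1`
by the sum of the floors of `m / 2 ^ i`. -/
theorem griesmerSum_two_pow_sub {k m : ℕ} (hm : m ≤ 2 ^ k) :
    griesmerSum (k + 1) (2 ^ k - m) + ∑ i ∈ Finset.range (k + 1), m / 2 ^ i = 2 ^ (k + 1) - 1 := by
  rw [← sum_two_pow_div_two_pow (Nat.lt_succ_self k), griesmerSum, ← Finset.sum_add_distrib]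
  refine Finset.sum_congr rfl fun i hi => ?_
  have hi' : i ≤ k := Nat.lt_succ_iff.mp (Finset.mem_range.mp hi)
  have hq : 0 < 2 ^ i := by positivity
  have hle : m / 2 ^ i ≤ 2 ^ k / 2 ^ i := Nat.div_le_div_right hm
  have hk : 2 ^ k = 2 ^ (k - i) * 2 ^ i := by rw [← pow_add, Nat.sub_add_cancel hi']
  have : ⌈((2 ^ k - m : ℕ) : ℚ) / 2 ^ i⌉₊ = 2 ^ k / 2 ^ i - m / 2 ^ i := by
    refine eq_of_forall_ge_iff fun c => ?_
    rw [ceil_div_two_pow_le_iff, tsub_le_iff_right, tsub_le_iff_right, add_comm (c * _),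
      add_comm c, ← Nat.add_mul_div_right _ _ hq, Nat.le_div_iff_mul_le hq, hk,
      Nat.mul_div_cancel _ hq]
  omega

theorem griesmerSum_two_pow_sub_two_pow {a k : ℕ} (ha : a ≤ k) :
    griesmerSum (k + 1) (2 ^ k - 2 ^ a) = 2 ^ (k + 1) - 2 ^ (a + 1) := by
  have h := griesmerSum_two_pow_sub (Nat.pow_le_pow_right two_pos ha)
  rw [sum_two_pow_div_two_pow (by omega)] at h
  have := Nat.one_le_two_pow (n := a + 1)
  omega

/-- Distinct powers of two add without carries. -/
theorem two_pow_add_two_pow_div {a b : ℕ} (h : a < b) (i : ℕ) :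
    (2 ^ a + 2 ^ b) / 2 ^ i = 2 ^ a / 2 ^ i + 2 ^ b / 2 ^ i := by
  rcases le_or_gt i b with hi | hi
  · obtain ⟨c, rfl⟩ := Nat.exists_eq_add_of_le hi
    rw [pow_add, Nat.add_mul_div_left _ _ (by positivity),
      Nat.mul_div_cancel_left _ (by positivity)]
  · have h1 : 2 ^ (a + 1) ≤ 2 ^ b := Nat.pow_le_pow_right two_pos h
    have h2 : 2 ^ (b + 1) ≤ 2 ^ i := Nat.pow_le_pow_right two_pos hi
    rw [pow_succ] at h1 h2
    have := Nat.one_le_two_pow (n := a)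
    rw [Nat.div_eq_of_lt, Nat.div_eq_of_lt, Nat.div_eq_of_lt] <;> omega

theorem griesmerSum_two_pow_sub_sub {a b k : ℕ} (hab : a ≠ b) (ha : a < k) (hb : b < k) :
    griesmerSum (k + 1) (2 ^ k - 2 ^ a - 2 ^ b) = 2 ^ (k + 1) - 2 ^ (a + 1) - 2 ^ (b + 1) + 1 := by
  wlog h : a < b generalizing a b
  · rw [Nat.sub_right_comm, this hab.symm hb ha (by omega), Nat.sub_right_comm]
  have h1 : 2 ^ (a + 1) ≤ 2 ^ b := Nat.pow_le_pow_right two_pos h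
  have h2 : 2 ^ (b + 1) ≤ 2 ^ k := Nat.pow_le_pow_right two_pos hb
  have := Nat.one_le_two_pow (n := a)
  have h3 := griesmerSum_two_pow_sub (k := k) (m := 2 ^ a + 2 ^ b)
    (by rw [pow_succ] at h1 h2; omega)
  simp only [two_pow_add_two_pow_div h, Finset.sum_add_distrib] at h3
  rw [sum_two_pow_div_two_pow (by omega), sum_two_pow_div_two_pow (by omega), ← Nat.sub_sub] at h3
  rw [pow_succ] at h1 h2 h3 ⊢
  rw [pow_succ] at h3 ⊢
  rw [pow_succ] at h3 ⊢
  omega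

/-! ### The Griesmer bound -/

/-- Passing to the residual code: on the zeros of a codeword `b`, a word `a` keeps half of what
the weights of `a` and `a + b` exceed that of `b`. -/
theorem hammingNorm_add_hammingNorm_add {ι : Type} [Fintype ι] (a b : ι → ZMod 2) :
    hammingNorm a + hammingNorm (a + b) =
      2 * hammingNorm (fun i : {i // b i = 0} => a i) + hammingNorm b := by
  have key : ∀ x y : ZMod 2, (if x ≠ 0 then 1 else 0) + (if x + y ≠ 0 then 1 else 0) =
      2 * (if y = 0 then (if x ≠ 0 then 1 else 0) else 0) + (if y ≠ 0 then 1 else 0) := by decide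
  have h1 : hammingNorm (fun i : {i // b i = 0} => a i) =
      ∑ i, if b i = 0 then (if a i ≠ 0 then 1 else 0) else 0 := by
    rw [hammingNorm, Finset.card_filter]
    exact (Finset.sum_subtype (p := fun i => b i = 0) (Finset.univ.filter fun i => b i = 0)
      (by simp) fun i => if a i ≠ 0 then 1 else 0).symm.trans (Finset.sum_filter _ _)
  rw [h1]
  simp only [hammingNorm, Finset.card_filter, Pi.add_apply, Finset.mul_sum,
    ← Finset.sum_add_distrib]
  exact Finset.sum_congr rfl fun i _ => key _ _

/-- The Griesmer bound for a binary linear code, given as the image of a linear map. -/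
theorem griesmerSum_le_card (k : ℕ) : ∀ {V ι : Type} [AddCommGroup V] [Module (ZMod 2) V]
    [FiniteDimensional (ZMod 2) V] [Fintype ι] (φ : V →ₗ[ZMod 2] ι → ZMod 2) (δ : ℕ),
    Module.finrank (ZMod 2) V = k → (∀ v, v ≠ 0 → δ ≤ hammingNorm (φ v)) →
    griesmerSum k δ ≤ Fintype.card ι := by
  induction k with
  | zero => intros; simp [griesmerSum]
  | succ k ih =>
    intro V ι _ _ _ _ φ δ hV hδ
    have hne : {v : V | v ≠ 0}.Nonempty := by
      have : Nontrivial V := Module.nontrivial_of_finrank_pos (R := ZMod 2) (by omega)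
      exact exists_ne 0
    obtain ⟨b, hb0, hb⟩ := Nat.sInf_mem (hne.image fun v => hammingNorm (φ v))
    have hmin : ∀ v, v ≠ 0 → hammingNorm (φ b) ≤ hammingNorm (φ v) := fun v hv =>
      hb.trans_le (Nat.sInf_le ⟨v, hv, rfl⟩)
    -- a complement of the line through a word `b` of minimum weight carries the residual code
    obtain ⟨W, hW⟩ := Submodule.exists_isCompl (Submodule.span (ZMod 2) {b})
    have hWk : Module.finrank (ZMod 2) W = k := by
      have := Submodule.finrank_add_eq_of_isCompl hW
      rw [finrank_span_singleton hb0] at this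
      omega
    let res : (ι → ZMod 2) →ₗ[ZMod 2] ({i // φ b i = 0} → ZMod 2) :=
      LinearMap.funLeft (ZMod 2) (ZMod 2) Subtype.val
    have hres := ih (res ∘ₗ φ ∘ₗ W.subtype) ((hammingNorm (φ b) + 1) / 2) hWk (by
      intro v hv
      have hv0 : (v : V) ≠ 0 := by simpa using hv
      have hvb : (v : V) + b ≠ 0 := by
        intro h0
        have hmem : (v : V) ∈ Submodule.span (ZMod 2) {b} := by
          rw [eq_neg_of_add_eq_zero_left h0]
          exact Submodule.neg_mem _ (Submodule.mem_span_singleton_self b)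
        exact hv0 (Submodule.disjoint_def.mp hW.disjoint _ hmem v.2)
      have h1 := hammingNorm_add_hammingNorm_add (φ v) (φ b)
      have h2 := hmin _ hv0
      have h3 := hmin _ hvb
      rw [map_add] at h3
      change _ ≤ hammingNorm (fun i : {i // φ b i = 0} => φ v i)
      omega)
    have hcard : Fintype.card {i // φ b i = 0} + hammingNorm (φ b) = Fintype.card ι := by
      rw [Fintype.card_subtype, hammingNorm, ← Finset.card_univ]
      exact Finset.card_filter_add_card_filter_not (fun i => φ b i = 0)
    have := griesmerSum_mono (k + 1) (hδ b hb0)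
    rw [griesmerSum_succ k (hammingNorm _)] at this
    omega

/-! ### Binary coordinates on the field with four elements -/

/-- The element `a + w b` of the field with four elements with binary coordinates `(a, b)`. -/
noncomputable def ofCoords (w : F4) : (ZMod 2 × ZMod 2) →ₗ[ZMod 2] F4 :=
  (Algebra.linearMap (ZMod 2) F4).coprod
    (LinearMap.mulLeft (ZMod 2) w ∘ₗ Algebra.linearMap (ZMod 2) F4)

theorem ofCoords_apply (w : F4) (a b : ZMod 2) :
    ofCoords w (a, b) = algebraMap (ZMod 2) F4 a + w * algebraMap (ZMod 2) F4 b := by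
  simp [ofCoords]

theorem ofCoords_bijective {w : F4} (hw : w ^ 2 + w + 1 = 0) :
    Function.Bijective (ofCoords w) := by
  rw [Fintype.bijective_iff_injective_and_card]
  constructor
  · rw [injective_iff_map_eq_zero]
    rintro ⟨a, b⟩ h
    rw [ofCoords_apply] at h
    have hinj := (algebraMap (ZMod 2) F4).injective
    have hb : ∀ x : ZMod 2, x = 0 ∨ x = 1 := by decide
    rcases hb b with rfl | rfl
    · have : a = 0 := hinj (by simpa using h)
      simp [this]
    · -- otherwise `w` would be a root of `x ^ 2 + x + 1` in the prime field
      have h1 : w = algebraMap (ZMod 2) F4 (-a) := by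
        rw [map_neg]
        simpa using eq_neg_of_add_eq_zero_right h
      have h2 : (-a) ^ 2 + (-a) + 1 = 0 := hinj (by
        rw [map_add, map_add, map_pow, map_one, map_zero, ← h1, hw])
      exact absurd h2 ((by decide : ∀ x : ZMod 2, x ^ 2 + x + 1 ≠ 0) (-a))
  · rw [← Nat.card_eq_fintype_card (α := F4), GaloisField.card 2 2 (by norm_num)]
    simp

/-- Multiplication by `w` in binary coordinates, using `w ^ 2 = 1 + w`. -/
theorem mul_ofCoords {w : F4} (hw : w ^ 2 + w + 1 = 0) (a b : ZMod 2) :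
    w * ofCoords w (a, b) = ofCoords w (b, a + b) := by
  have h2 : (2 : F4) = 0 := CharTwo.two_eq_zero
  simp only [ofCoords_apply, map_add]
  linear_combination (algebraMap (ZMod 2) F4 b) * hw -
    (algebraMap (ZMod 2) F4 b) * (1 + w) * h2

/-- The additive Griesmer bound: concatenation with the binary `[3, 2, 2]` code turns an additive
code of length `n` into a binary linear code of length `3 n` with all weights doubled. -/
theorem griesmerSum_le_of_isAdditiveCode {w : F4} (hw : w ^ 2 + w + 1 = 0) {n k d : ℕ}
    {C : AddSubgroup (Fin n → F4)} (hC : IsAdditiveCode n k d C) :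
    griesmerSum k (2 * d) ≤ 3 * n := by
  let e := LinearEquiv.ofBijective (ofCoords w) (ofCoords_bijective hw)
  let M : Submodule (ZMod 2) (Fin n → F4) := AddSubgroup.toZModSubmodule 2 C
  let t : (ZMod 2 × ZMod 2) →ₗ[ZMod 2] (Fin 3 → ZMod 2) :=
    LinearMap.pi ![LinearMap.fst _ _ _, LinearMap.snd _ _ _,
      LinearMap.fst _ _ _ + LinearMap.snd _ _ _]
  let φ : M →ₗ[ZMod 2] (Fin n × Fin 3 → ZMod 2) :=
    LinearMap.pi fun ij => LinearMap.proj ij.2 ∘ₗ t ∘ₗ e.symm.toLinearMap ∘ₗ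
      LinearMap.proj ij.1 ∘ₗ M.subtype
  have ht : ∀ p : ZMod 2 × ZMod 2,
      ∑ j, (if t p j ≠ 0 then 1 else 0) = 2 * (if p ≠ 0 then 1 else 0) := by
    have : ∀ p : ZMod 2 × ZMod 2, ((if p.1 ≠ 0 then 1 else 0) + (if p.2 ≠ 0 then 1 else 0)) +
        (if p.1 + p.2 ≠ 0 then 1 else 0) = 2 * (if p ≠ 0 then 1 else 0) := by decide
    intro p
    rw [Fin.sum_univ_three]
    exact this p
  have hφ : ∀ c : M, hammingNorm (φ c) = 2 * hammingNorm (c : Fin n → F4) := by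
    intro c
    simp only [hammingNorm, Finset.card_filter, Finset.mul_sum]
    rw [Fintype.sum_prod_type]
    refine Finset.sum_congr rfl fun i _ => (ht (e.symm ((c : Fin n → F4) i))).trans ?_
    simp
  have hk : Module.finrank (ZMod 2) M = k := by
    have h1 : Nat.card M = 2 ^ k := hC.card_eq
    have h2 := Module.natCard_eq_pow_finrank (K := ZMod 2) (V := M)
    rw [h1, Nat.card_zmod] at h2
    exact (Nat.pow_right_injective le_rfl h2).symm
  have := griesmerSum_le_card k φ (2 * d) hk fun c hc => by
    rw [hφ]
    exact Nat.mul_le_mul_left 2 (hC.isLeast_weight.2 ⟨c, c.2, by simpa using hc, rfl⟩)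
  simpa [mul_comm] using this

/-! ### Codes parametrized by a group of messages -/

section Parametrized

theorem injective_of_hammingNorm_ne_zero {Λ : Type} [AddCommGroup Λ] {n : ℕ}
    {ev : Λ →+ (Fin n → F4)} (h : ∀ u, u ≠ 0 → hammingNorm (ev u) ≠ 0) :
    Function.Injective ev :=
  (injective_iff_map_eq_zero ev).mpr fun u hu => by
    by_contra h0
    exact h u h0 (by simp [hu])

variable {Λ : Type} [AddCommGroup Λ] [Fintype Λ] {n k : ℕ} {C : AddSubgroup (Fin n → F4)}
  {ev : Λ →+ (Fin n → F4)}

theorem weightCount_eq_card (hC : ev.range = C) (hinj : Function.Injective ev) (i : ℕ) :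
    weightCount C i = (Finset.univ.filter fun u => hammingNorm (ev u) = i).card := by
  have : {c : Fin n → F4 | c ∈ C ∧ hammingNorm c = i} =
      ev '' ((Finset.univ.filter fun u => hammingNorm (ev u) = i : Finset Λ) : Set Λ) := by
    ext c
    simp only [← hC, AddMonoidHom.mem_range, Set.mem_ofPred_eq, Set.mem_image, Finset.coe_filter,
      Finset.mem_univ, true_and]
    constructor
    · rintro ⟨⟨u, rfl⟩, hu⟩
      exact ⟨u, hu, rfl⟩
    · rintro ⟨u, hu, rfl⟩
      exact ⟨⟨u, rfl⟩, hu⟩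
  rw [weightCount, this, Set.ncard_image_of_injective _ hinj, Set.ncard_coe_finset]

theorem weightDistribution_eq_sum (hC : ev.range = C) (hinj : Function.Injective ev) :
    weightDistribution C = ∑ u, (X : ℤ[X]) ^ hammingNorm (ev u) := by
  classical
  have h0 : ∀ u, u ∈ Finset.univ.erase (0 : Λ) → hammingNorm (ev u) ∈ Finset.Icc 1 n := by
    intro u hu
    have : ev u ≠ 0 := fun h => Finset.ne_of_mem_erase hu (hinj (by rw [h, map_zero]))
    rw [Finset.mem_Icc]
    exact ⟨hammingNorm_pos_iff.mpr this, by simpa using hammingNorm_le_card_fintype (x := ev u)⟩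
  rw [← Finset.add_sum_erase _ _ (Finset.mem_univ (0 : Λ)), map_zero, hammingNorm_zero, pow_zero,
    weightDistribution, ← Finset.sum_fiberwise_of_maps_to h0]
  congr 1
  refine Finset.sum_congr rfl fun i hi => ?_
  rw [weightCount_eq_card hC hinj, Finset.sum_congr rfl (g := fun _ => (X : ℤ[X]) ^ i)
    (fun u hu => by rw [(Finset.mem_filter.mp hu).2]), Finset.sum_const, nsmul_eq_mul]
  congr 3
  ext u
  simp only [Finset.mem_filter, Finset.mem_univ, true_and, Finset.mem_erase, and_true]
  refine ⟨fun h => ⟨?_, h⟩, fun h => h.2⟩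
  rintro rfl
  rw [map_zero, hammingNorm_zero] at h
  simp [← h] at hi

theorem isTWeight_of_image [DecidableEq Λ] (hC : ev.range = C) (hinj : Function.Injective ev)
    {t : ℕ} (ht : ((Finset.univ.erase (0 : Λ)).image fun u => hammingNorm (ev u)).card = t) :
    IsTWeight t C := by
  rw [IsTWeight, ← ht]
  congr 1
  ext i
  simp only [weightCount_eq_card hC hinj, Finset.mem_filter, Finset.mem_Icc, ne_eq,
    Finset.card_eq_zero, Finset.filter_eq_empty_iff, Finset.mem_image, Finset.mem_erase,
    Finset.mem_univ, and_true, true_implies, not_forall, not_not]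
  constructor
  · rintro ⟨⟨hi, _⟩, u, rfl⟩
    refine ⟨u, ?_, rfl⟩
    rintro rfl
    simp at hi
  · rintro ⟨u, hu, rfl⟩
    have : ev u ≠ 0 := fun h => hu (hinj (by rw [h, map_zero]))
    exact ⟨⟨hammingNorm_pos_iff.mpr this,
      by simpa using hammingNorm_le_card_fintype (x := ev u)⟩, u, rfl⟩

theorem isAdditiveCode_of_param (hC : ev.range = C) (hinj : Function.Injective ev)
    (hk : Fintype.card Λ = 2 ^ k) {d : ℕ} (hd : ∃ u, u ≠ 0 ∧ hammingNorm (ev u) = d)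
    (hmin : ∀ u, u ≠ 0 → d ≤ hammingNorm (ev u)) : IsAdditiveCode n k d C where
  card_eq := by
    rw [← hk, ← Nat.card_eq_fintype_card, ← hC]
    exact (Nat.card_congr (AddMonoidHom.ofInjective hinj).toEquiv).symm
  isLeast_weight := by
    constructor
    · obtain ⟨u, hu, rfl⟩ := hd
      exact ⟨ev u, hC ▸ ⟨u, rfl⟩, fun h => hu (hinj (by rw [h, map_zero])), rfl⟩
    · rintro m ⟨c, hc, hc0, rfl⟩
      obtain ⟨u, rfl⟩ := AddMonoidHom.mem_range.mp (hC ▸ hc)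
      exact hmin u fun h => hc0 (by rw [h, map_zero])

end Parametrized

/-- The weights occurring for codes whose messages are pairs, when the weight of a codeword depends
only on which components of its message vanish: `a` if neither does, `b` if only the second does,
`c` if only the first does. -/
def pairWeight {D₁ D₂ : Type} [Zero D₁] [Zero D₂] [DecidableEq D₁] [DecidableEq D₂] (a b c : ℕ)
    (u : D₁ × D₂) : ℕ :=
  if u.1 = 0 then (if u.2 = 0 then 0 else c) else (if u.2 = 0 then b else a)

section Pair

variable {D₁ D₂ : Type} [AddCommGroup D₁] [AddCommGroup D₂] [Fintype D₁] [Fintype D₂]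
  [DecidableEq D₁] [DecidableEq D₂] {a b c : ℕ}

theorem sum_ite_eq_zero {D : Type} [Zero D] [Fintype D] [DecidableEq D] (P Q : ℤ[X]) :
    ∑ u : D, (if u = 0 then P else Q) = P + ((Fintype.card D : ℤ[X]) - 1) * Q := by
  rw [← Finset.add_sum_erase _ _ (Finset.mem_univ (0 : D)), if_pos rfl,
    Finset.sum_congr rfl (g := fun _ => Q) fun u hu => if_neg (Finset.ne_of_mem_erase hu),
    Finset.sum_const, nsmul_eq_mul, Finset.card_erase_of_mem (Finset.mem_univ _),
    Finset.card_univ, Nat.cast_sub (Fintype.card_pos_iff.mpr ⟨0⟩), Nat.cast_one]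

theorem sum_X_pow_pairWeight :
    ∑ u : D₁ × D₂, (X : ℤ[X]) ^ pairWeight a b c u =
      1 + ((Fintype.card D₁ : ℤ[X]) - 1) * ((Fintype.card D₂ : ℤ[X]) - 1) * X ^ a
        + ((Fintype.card D₁ : ℤ[X]) - 1) * X ^ b + ((Fintype.card D₂ : ℤ[X]) - 1) * X ^ c := by
  rw [Fintype.sum_prod_type]
  simp only [pairWeight, apply_ite (fun i => (X : ℤ[X]) ^ i), Finset.sum_ite_irrel,
    sum_ite_eq_zero]
  ring

theorem image_pairWeight [Nontrivial D₁] [Nontrivial D₂] :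
    (Finset.univ.erase (0 : D₁ × D₂)).image (pairWeight a b c) = {a, b, c} := by
  obtain ⟨x, hx⟩ := exists_ne (0 : D₁)
  obtain ⟨y, hy⟩ := exists_ne (0 : D₂)
  ext i
  simp only [Finset.mem_image, Finset.mem_erase, Finset.mem_univ, and_true, Prod.exists, ne_eq,
    Prod.mk_eq_zero, Finset.mem_insert, Finset.mem_singleton]
  constructor
  · rintro ⟨u, v, huv, rfl⟩
    unfold pairWeight
    split_ifs <;> simp_all
  · rintro (rfl | rfl | rfl)
    · exact ⟨x, y, by simp [hx], by simp [pairWeight, hx, hy]⟩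
    · exact ⟨x, 0, by simp [hx], by simp [pairWeight, hx]⟩
    · exact ⟨0, y, by simp [hy], by simp [pairWeight, hy]⟩

end Pair

/-! ### Counting points off a hyperplane -/

theorem two_mul_card_ne_zero {V : Type} [AddCommGroup V] [Module (ZMod 2) V] [Fintype V]
    (u : Module.Dual (ZMod 2) V) [Decidable (u = 0)] :
    2 * (∑ x, if u x ≠ 0 then 1 else 0) = if u = 0 then 0 else Fintype.card V := by
  split_ifs with h
  · simp [h]
  · obtain ⟨v, hv⟩ : ∃ v, u v ≠ 0 := by
      by_contra! h0
      exact h (LinearMap.ext h0)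
    have key : ∀ p q : ZMod 2, q ≠ 0 →
        (if p ≠ 0 then 1 else 0) + (if p + q ≠ 0 then 1 else 0) = 1 := by decide
    -- translation by `v` exchanges the hyperplane and its complement
    calc 2 * (∑ x, if u x ≠ 0 then 1 else 0)
        = (∑ x, if u x ≠ 0 then 1 else 0) + ∑ x, if u (x + v) ≠ 0 then 1 else 0 := by
          rw [two_mul, Fintype.sum_equiv (Equiv.addRight v)
            (fun x => if u (x + v) ≠ 0 then 1 else 0)
            (fun x => if u x ≠ 0 then 1 else 0) fun x => rfl]
      _ = Fintype.card V := by
          rw [← Finset.sum_add_distrib, Finset.sum_congr rfl (g := fun _ => 1) fun x _ => by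
            rw [map_add]; exact key _ _ hv]
          simp

/-- The number of points `(y, z)` with `y ∈ Y`, `z ≠ 0` off the hyperplane of a functional on a
product. -/
def offCount {V₁ V₂ : Type} [AddCommGroup V₁] [Module (ZMod 2) V₁] [AddCommGroup V₂]
    [Module (ZMod 2) V₂] [Fintype V₂] [DecidableEq V₂] (Y : Finset V₁)
    (u : Module.Dual (ZMod 2) V₁ × Module.Dual (ZMod 2) V₂) : ℕ :=
  ∑ y ∈ Y, ∑ z ∈ Finset.univ.erase (0 : V₂), if u.1 y + u.2 z ≠ 0 then 1 else 0

theorem two_mul_offCount_univ {V₁ V₂ : Type} [AddCommGroup V₁] [Module (ZMod 2) V₁] [Fintype V₁]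
    [AddCommGroup V₂] [Module (ZMod 2) V₂] [Fintype V₂] [DecidableEq V₂]
    [DecidableEq (Module.Dual (ZMod 2) V₁)] [DecidableEq (Module.Dual (ZMod 2) V₂)]
    (u : Module.Dual (ZMod 2) V₁ × Module.Dual (ZMod 2) V₂) :
    2 * offCount Finset.univ u + (if u.1 = 0 then 0 else Fintype.card V₁) =
      if u.1 = 0 ∧ u.2 = 0 then 0 else Fintype.card V₁ * Fintype.card V₂ := by
  classical
  have h := two_mul_card_ne_zero (u.1.coprod u.2)
  have h0 : u.1.coprod u.2 = 0 ↔ u.1 = 0 ∧ u.2 = 0 := by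
    refine ⟨fun h => ⟨?_, ?_⟩, fun ⟨h₁, h₂⟩ => by rw [h₁, h₂]; ext <;> simp⟩
    · rw [← LinearMap.coprod_inl u.1 u.2, h, LinearMap.zero_comp]
    · rw [← LinearMap.coprod_inr u.1 u.2, h, LinearMap.zero_comp]
  have h1 := two_mul_card_ne_zero u.1
  simp only [h0, Fintype.card_prod, LinearMap.coprod_apply] at h
  rw [← h, ← h1, offCount, Fintype.sum_prod_type, ← mul_add, ← Finset.sum_add_distrib]
  congr 1
  refine Finset.sum_congr rfl fun y _ => ?_
  have hz := Finset.add_sum_erase Finset.univ (fun z => if u.1 y + u.2 z ≠ 0 then 1 else 0)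
    (Finset.mem_univ (0 : V₂))
  simp only [map_zero, add_zero] at hz
  rw [add_comm]
  exact hz

theorem two_mul_offCount_erase {V₁ V₂ : Type} [AddCommGroup V₁] [Module (ZMod 2) V₁] [Fintype V₁]
    [DecidableEq V₁] [AddCommGroup V₂] [Module (ZMod 2) V₂] [Fintype V₂] [DecidableEq V₂]
    [DecidableEq (Module.Dual (ZMod 2) V₁)] [DecidableEq (Module.Dual (ZMod 2) V₂)]
    (u : Module.Dual (ZMod 2) V₁ × Module.Dual (ZMod 2) V₂) :
    2 * offCount (Finset.univ.erase 0) u + (if u.1 = 0 then 0 else Fintype.card V₁) +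
      (if u.2 = 0 then 0 else Fintype.card V₂) =
      if u.1 = 0 ∧ u.2 = 0 then 0 else Fintype.card V₁ * Fintype.card V₂ := by
  rw [← two_mul_offCount_univ, ← two_mul_card_ne_zero u.2, offCount, offCount,
    ← Finset.add_sum_erase Finset.univ _ (Finset.mem_univ (0 : V₁)),
    ← Finset.add_sum_erase Finset.univ (fun z => if u.2 z ≠ 0 then 1 else 0)
      (Finset.mem_univ (0 : V₂))]
  simp only [map_zero, zero_add, ne_eq, not_true_eq_false, if_false]
  ring

/-! ### Generator multisets consisting of lines of a linear map -/

/-- The vector `x + w x'` over the field with four elements; its binary row space spans the line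
through the points `x` and `x'`. -/
noncomputable def lineVec (w : F4) {R : Type} (x x' : R → ZMod 2) : R → F4 :=
  fun r => ofCoords w (x r, x' r)

theorem lineVec_zero (w : F4) (R : Type) : lineVec w (0 : R → ZMod 2) 0 = 0 :=
  funext fun _ => map_zero (ofCoords w)

theorem map_product_map {α β γ δ : Type} (f : α → γ) (g : β → δ) (s : Multiset α)
    (t : Multiset β) : s.map f ×ˢ t.map g = (s ×ˢ t).map (Prod.map f g) := by
  simp [SProd.sprod, Multiset.product, Multiset.bind_map, Multiset.map_bind]

theorem columns_fromCols {R ι κ : Type} [Fintype ι] [Fintype κ] (A : Matrix R ι F4)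
    (B : Matrix R κ F4) : columns (Matrix.fromCols A B) = columns A + columns B := by
  unfold columns
  rw [← Finset.univ_disjSum_univ, Finset.val_disjSum, Multiset.disjSum, Multiset.map_add,
    Multiset.map_map, Multiset.map_map]
  rfl

theorem columns_padAbove {R₁ R₂ ι : Type} [Fintype ι] (B : Matrix R₂ ι F4) :
    columns (padAbove R₁ B) = (columns B).map fun β => Sum.elim (0 : R₁ → F4) β := by
  unfold columns
  rw [Multiset.map_map]
  refine Multiset.map_congr rfl fun j _ => funext fun r => ?_
  cases r <;> rfl

theorem columns_starProd {R₁ R₂ ι κ : Type} [Fintype ι] [Fintype κ] (A : Matrix R₁ ι F4)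
    (B : Matrix R₂ κ F4) :
    columns (starProd A B) = (columns A ×ˢ columns B).map fun p => Sum.elim p.1 p.2 := by
  unfold columns
  rw [map_product_map, Multiset.map_map, ← Finset.univ_product_univ, Finset.product_val]
  refine Multiset.map_congr rfl fun j _ => funext fun r => ?_
  cases r <;> rfl

theorem columns_combine {R₁ R₂ ι κ : Type} [Fintype ι] [Fintype κ] (A : Matrix R₁ ι F4)
    (B : Matrix R₂ κ F4) :
    columns (combine A B) = (columns A ×ˢ columns B).map (fun p => Sum.elim p.1 p.2) +
      (columns (padBelow R₂ A) + columns (padAbove R₁ B)) := by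
  have : Matrix.fromBlocks A 0 0 B = Matrix.fromCols (padBelow R₂ A) (padAbove R₁ B) := by
    ext i j
    cases i <;> cases j <;> rfl
  rw [combine, columns_fromCols, columns_starProd, this, columns_fromCols]

/-! ### The cubic and its iterations -/

theorem map_col_eq_of_isSimplexGenerator {R ι : Type} [Fintype R] [DecidableEq R] [Fintype ι]
    {S : Matrix R ι (ZMod 2)} (hS : IsSimplexGenerator S) :
    (Finset.univ : Finset ι).val.map (fun j r => S r j) =
      ((Finset.univ : Finset (R → ZMod 2)).erase 0).val := by
  have h1 : ∀ a : ZMod 2, a ≠ 0 → a = 1 := by decide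
  have hinj : Function.Injective fun j r => S r j := by
    intro i j hij
    refine (hS.existsUnique _ (hS.col_ne_zero i)).unique ⟨1, one_ne_zero, by simp⟩
      ⟨1, one_ne_zero, ?_⟩
    simpa using hij
  rw [← Finset.image_val_of_injOn hinj.injOn]
  congr 1
  ext v
  simp only [Finset.mem_image, Finset.mem_univ, true_and, Finset.mem_erase, and_true]
  constructor
  · rintro ⟨j, rfl⟩
    exact hS.col_ne_zero j
  · intro hv
    obtain ⟨j, ⟨a, ha, hj⟩, -⟩ := hS.existsUnique v hv
    exact ⟨j, by rw [hj, h1 a ha]; simp⟩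

/-- Multiplication by a root of the cubic `f`, in suitable coordinates. -/
noncomputable def cubicMap (f : (ZMod 2)[X]) : (Fin 3 → ZMod 2) →ₗ[ZMod 2] (Fin 3 → ZMod 2) :=
  LinearMap.pi ![LinearMap.proj 1, LinearMap.proj 2, ∑ m : Fin 3, f.coeff m • LinearMap.proj m]

/-- A linear map `T` for which `T` and `T + 1` are both injective. The points `x`, `T x`, `x + T x`
then form a line for every nonzero `x`, and each of them runs through all nonzero points. -/
structure IsOrthomorphism {V : Type} [AddCommGroup V] [Module (ZMod 2) V] (T : V →ₗ[ZMod 2] V) :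
    Prop where
  eq_zero_of_map : ∀ x, T x = 0 → x = 0
  eq_zero_of_add : ∀ x, x + T x = 0 → x = 0

theorem isOrthomorphism_cubicMap {f : (ZMod 2)[X]} (hf : f.Monic) (hirr : Irreducible f)
    (hdeg : f.natDegree = 3) : IsOrthomorphism (cubicMap f) := by
  have hroot : ∀ x, f.eval x ≠ 0 := fun x hx => by
    have := Polynomial.degree_eq_one_of_irreducible_of_root hirr hx
    rw [Polynomial.degree_eq_natDegree hf.ne_zero, hdeg] at this
    norm_num at this
  have h3 : f.coeff 3 = 1 := hdeg ▸ hf.coeff_natDegree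
  have h0 := hroot 0
  have h1 := hroot 1
  rw [Polynomial.eval_eq_sum_range, hdeg] at h0 h1
  simp only [Finset.sum_range_succ, Finset.sum_range_zero, h3] at h0 h1
  have e0 : ∀ x, cubicMap f x 0 = x 1 := fun x => rfl
  have e1 : ∀ x, cubicMap f x 1 = x 2 := fun x => rfl
  have e2 : ∀ x, cubicMap f x 2 = f.coeff 0 * x 0 + f.coeff 1 * x 1 + f.coeff 2 * x 2 := fun x => by
    simp [cubicMap, Fin.sum_univ_three]
  constructor
  · intro x hx
    have a0 := congrFun hx 0
    have a1 := congrFun hx 1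
    have a2 := congrFun hx 2
    rw [e0] at a0
    rw [e1] at a1
    rw [e2, a0, a1] at a2
    -- `f.coeff 0 = f.eval 0` is nonzero
    have : x 0 = 0 := by
      simp only [Pi.zero_apply, mul_zero, add_zero, mul_eq_zero] at a2
      exact a2.resolve_left (by simpa using h0)
    funext i
    fin_cases i
    exacts [this, a0, a1]
  · intro x hx
    have a0 := congrFun hx 0
    have a1 := congrFun hx 1
    have a2 := congrFun hx 2
    rw [Pi.add_apply, e0] at a0
    rw [Pi.add_apply, e1] at a1
    rw [Pi.add_apply, e2] at a2
    simp only [Pi.zero_apply] at a0 a1 a2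
    simp only [one_pow, mul_one, zero_add] at h1
    -- `x + T x = 0` forces all coordinates of `x` to agree, and `1` is not a root of `f`
    have key : ∀ c0 c1 c2 y0 y1 y2 : ZMod 2, c0 + c1 + c2 + 1 ≠ 0 → y0 + y1 = 0 → y1 + y2 = 0 →
        y2 + (c0 * y0 + c1 * y1 + c2 * y2) = 0 → y0 = 0 ∧ y1 = 0 ∧ y2 = 0 := by decide
    obtain ⟨b0, b1, b2⟩ := key _ _ _ _ _ _ h1 a0 a1 a2
    funext i
    fin_cases i
    exacts [b0, b1, b2]

/-- The direct sum of `T` with multiplication by `w` on the field with four elements, the latter in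
the coordinates `(a, b)` of `a + w b`. -/
def iterMap {R : Type} (T : (R → ZMod 2) →ₗ[ZMod 2] (R → ZMod 2)) :
    (R ⊕ Fin 2 → ZMod 2) →ₗ[ZMod 2] (R ⊕ Fin 2 → ZMod 2) where
  toFun x := Sum.elim (T fun r => x (Sum.inl r)) ![x (Sum.inr 1), x (Sum.inr 0) + x (Sum.inr 1)]
  map_add' x y := by
    funext r
    rcases r with r | r
    · exact congrFun (T.map_add (fun r => x (Sum.inl r)) fun r => y (Sum.inl r)) r
    · fin_cases r <;> simp [add_add_add_comm]
  map_smul' c x := by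
    funext r
    rcases r with r | r
    · exact congrFun (T.map_smul c fun r => x (Sum.inl r)) r
    · fin_cases r <;> simp [mul_add]

theorem IsOrthomorphism.iterMap {R : Type} {T : (R → ZMod 2) →ₗ[ZMod 2] (R → ZMod 2)}
    (hT : IsOrthomorphism T) : IsOrthomorphism (iterMap T) := by
  constructor
  · intro x hx
    have a := hT.eq_zero_of_map (fun r => x (Sum.inl r)) (funext fun r => congrFun hx (Sum.inl r))
    have b1 : x (Sum.inr 1) = 0 := congrFun hx (Sum.inr 0)
    have b2 : x (Sum.inr 0) + x (Sum.inr 1) = 0 := congrFun hx (Sum.inr 1)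
    rw [b1, add_zero] at b2
    funext r
    rcases r with r | r
    · exact congrFun a r
    · fin_cases r
      exacts [b2, b1]
  · intro x hx
    have a := hT.eq_zero_of_add (fun r => x (Sum.inl r)) (funext fun r => congrFun hx (Sum.inl r))
    have b1 : x (Sum.inr 0) + x (Sum.inr 1) = 0 := congrFun hx (Sum.inr 0)
    have b2 : x (Sum.inr 1) + (x (Sum.inr 0) + x (Sum.inr 1)) = 0 := congrFun hx (Sum.inr 1)
    rw [b1, add_zero] at b2
    rw [b2, add_zero] at b1
    funext r
    rcases r with r | r
    · exact congrFun a r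
    · fin_cases r
      exacts [b1, b2]

/-- Adjoining a zero column turns one step of the iteration into a product of column multisets. -/
theorem zero_cons_columns_iterStep {R ι : Type} [Fintype ι] [Fintype R] [DecidableEq R] {w : F4}
    (hw : w ^ 2 + w + 1 = 0) {T : (R → ZMod 2) →ₗ[ZMod 2] (R → ZMod 2)} {A : Matrix R ι F4}
    (hA : 0 ::ₘ columns A = Finset.univ.val.map fun x => lineVec w x (T x)) :
    0 ::ₘ columns (iterStep w A) =
      Finset.univ.val.map fun x => lineVec w x (iterMap T x) := by
  -- the column built from a column of `A`, or `0`, and an element `β`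
  let g : (R → F4) × F4 → (R ⊕ Fin 2 → F4) := fun p => Sum.elim p.1 ![p.2, w * p.2]
  have hF : (Finset.univ : Finset F4).val =
      0 ::ₘ (Finset.univ : Finset {β : F4 // β ≠ 0}).val.map Subtype.val := by
    have h1 : (Finset.univ : Finset {β : F4 // β ≠ 0}).val.map Subtype.val =
        ((Finset.univ : Finset F4).erase 0).val := by
      rw [← Finset.image_val_of_injOn Subtype.val_injective.injOn]
      congr 1
      ext β
      simp
    rw [h1, Finset.erase_val, Multiset.cons_erase (Finset.mem_univ_val 0)]
  have h1 : columns (iterStep w A) = (columns A ×ˢ (Finset.univ : Finset F4).val).map g +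
      ((Finset.univ : Finset {β : F4 // β ≠ 0}).val.map Subtype.val).map fun β => g (0, β) := by
    unfold columns
    rw [← Finset.univ_disjSum_univ, Finset.val_disjSum, Multiset.disjSum, Multiset.map_add,
      Multiset.map_map, Multiset.map_map, ← Finset.univ_product_univ, Finset.product_val,
      ← Multiset.map_id (Finset.univ : Finset F4).val, map_product_map,
      Multiset.map_map, Multiset.map_map, Multiset.map_id]
    congr 1
    · refine Multiset.map_congr rfl fun j _ => funext fun r => ?_
      cases r <;> rfl
    · refine Multiset.map_congr rfl fun j _ => funext fun r => ?_
      cases r <;> rfl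
  have hg0 : g (0, 0) = 0 := by
    funext r
    rcases r with r | r
    · rfl
    · fin_cases r <;> simp [g]
  have h2 : 0 ::ₘ columns (iterStep w A) =
      ((0 ::ₘ columns A) ×ˢ (Finset.univ : Finset F4).val).map g := by
    rw [Multiset.cons_product, Multiset.map_add, h1, ← Multiset.add_cons, add_comm,
      Multiset.map_map]
    congr 1
    rw [hF, Multiset.map_cons]
    simp [hg0]
  let e := Equiv.ofBijective _ (ofCoords_bijective hw)
  let Φ : (R → ZMod 2) × F4 ≃ (R ⊕ Fin 2 → ZMod 2) :=
    ((Equiv.refl _).prodCongr (e.symm.trans (finTwoArrowEquiv (ZMod 2)).symm)).trans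
      (Equiv.sumArrowEquivProdArrow R (Fin 2) (ZMod 2)).symm
  rw [h2, hA, ← Multiset.map_id (Finset.univ : Finset F4).val, map_product_map,
    Multiset.map_map, ← Finset.product_val, Finset.univ_product_univ,
    ← Finset.map_univ_equiv Φ, Finset.map_val, Multiset.map_map]
  refine Multiset.map_congr rfl fun p _ => funext fun r => ?_
  obtain ⟨x, β⟩ := p
  obtain ⟨⟨a, b⟩, rfl⟩ := e.surjective β
  have hΦ : Φ (x, e (a, b)) = Sum.elim x ![a, b] := by
    simp only [Φ, Equiv.trans_apply, Equiv.prodCongr_apply, Prod.map, Equiv.symm_apply_apply]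
    rfl
  simp only [Function.comp_apply, Equiv.coe_toEmbedding]
  rw [hΦ]
  rcases r with r | r
  · rfl
  · fin_cases r
    · rfl
    · exact mul_ofCoords hw a b

noncomputable instance instFintypeIterRows : (s : ℕ) → Fintype (IterRows s)
  | 0 => inferInstanceAs (Fintype (Fin 3))
  | s + 1 =>
    letI := instFintypeIterRows s
    inferInstanceAs (Fintype (IterRows s ⊕ Fin 2))

noncomputable instance instDecidableEqIterRows : (s : ℕ) → DecidableEq (IterRows s)
  | 0 => inferInstanceAs (DecidableEq (Fin 3))
  | s + 1 =>
    letI := instDecidableEqIterRows s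
    inferInstanceAs (DecidableEq (IterRows s ⊕ Fin 2))

theorem card_iterRows (s : ℕ) : Fintype.card (IterRows s) = 2 * s + 3 := by
  induction s with
  | zero => exact Fintype.card_fin 3
  | succ s ih =>
    have : Fintype.card (IterRows (s + 1)) = Fintype.card (IterRows s ⊕ Fin 2) :=
      Fintype.card_congr (Equiv.refl _)
    rw [this, Fintype.card_sum, ih, Fintype.card_fin]
    ring

/-- The vector `x = 0` contributes the zero column, so it may be included on both sides. -/
theorem zero_cons_columns_eq {R ι : Type} [Fintype ι] [Fintype R] [DecidableEq R] {w : F4}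
    {T : (R → ZMod 2) →ₗ[ZMod 2] (R → ZMod 2)} {A : Matrix R ι F4} :
    0 ::ₘ columns A = Finset.univ.val.map (fun x => lineVec w x (T x)) ↔
      columns A = (Finset.univ.erase 0).val.map fun x => lineVec w x (T x) := by
  rw [Finset.erase_val, ← Multiset.cons_erase (Finset.mem_univ_val (0 : R → ZMod 2)),
    Multiset.map_cons, Multiset.erase_cons_head]
  rw [map_zero, lineVec_zero, Multiset.cons_inj_right]

theorem columns_apsMatrix (w : F4) (f : (ZMod 2)[X]) {S : Matrix (Fin 3) (Fin 7) (ZMod 2)}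
    (hS : IsSimplexGenerator S) : columns (apsMatrix w f S) =
      (Finset.univ.erase 0).val.map fun x => lineVec w x (cubicMap f x) := by
  rw [← map_col_eq_of_isSimplexGenerator hS, Multiset.map_map]
  refine Multiset.map_congr rfl fun j _ => funext fun r => ?_
  simp only [Function.comp_apply, lineVec, ofCoords_apply, apsMatrix]
  congr 3
  fin_cases r
  · rfl
  · rfl
  · simp [cubicMap]

/-- The columns of the iterated matrix are the vectors `x + w T x`, one for each nonzero binary
vector `x`, for a single linear map `T`. -/
theorem exists_isOrthomorphism_iterMatrix {w : F4} (hw : w ^ 2 + w + 1 = 0) {f : (ZMod 2)[X]}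
    (hf : f.Monic) (hirr : Irreducible f) (hdeg : f.natDegree = 3)
    {S : Matrix (Fin 3) (Fin 7) (ZMod 2)} (hS : IsSimplexGenerator S) (s : ℕ) :
    ∃ T : (IterRows s → ZMod 2) →ₗ[ZMod 2] (IterRows s → ZMod 2), IsOrthomorphism T ∧
      columns (iterMatrix w (apsMatrix w f S) s) =
        (Finset.univ.erase 0).val.map fun x => lineVec w x (T x) := by
  suffices h : ∃ T : (IterRows s → ZMod 2) →ₗ[ZMod 2] (IterRows s → ZMod 2), IsOrthomorphism T ∧
      0 ::ₘ columns (iterMatrix w (apsMatrix w f S) s) =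
        Finset.univ.val.map fun x => lineVec w x (T x) by
    simpa only [zero_cons_columns_eq] using h
  induction s with
  | zero =>
    exact ⟨cubicMap f, isOrthomorphism_cubicMap hf hirr hdeg,
      zero_cons_columns_eq.mpr (columns_apsMatrix w f hS)⟩
  | succ s ih =>
    obtain ⟨T, hT, hA⟩ := ih
    exact ⟨iterMap T, hT.iterMap, zero_cons_columns_iterStep hw hA⟩

/-! ### The divided simplex code -/

/-- Multiplication by `w` on vectors `a + w b` over the field with four elements, given by their
binary coordinates `a` and `b`. -/
def mulMap (R : Type) : (R ⊕ R → ZMod 2) →ₗ[ZMod 2] (R ⊕ R → ZMod 2) where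
  toFun x := Sum.elim (fun r => x (Sum.inr r)) fun r => x (Sum.inl r) + x (Sum.inr r)
  map_add' x y := by
    funext r
    rcases r with r | r <;> simp [add_add_add_comm]
  map_smul' c x := by
    funext r
    rcases r with r | r <;> simp [mul_add]

theorem mulMap_mulMap {R : Type} (x : R ⊕ R → ZMod 2) :
    mulMap R (mulMap R x) = x + mulMap R x := by
  funext r
  rcases r with r | r
  · rfl
  · change x (Sum.inr r) + (x (Sum.inl r) + x (Sum.inr r)) =
      x (Sum.inr r) + (x (Sum.inl r) + x (Sum.inr r))
    rfl

/-- The binary coordinates of a vector over the field with four elements. -/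
noncomputable def vecCoords {w : F4} (hw : w ^ 2 + w + 1 = 0) (R : Type) :
    (R → F4) ≃ (R ⊕ R → ZMod 2) :=
  ((Equiv.refl R).arrowCongr (Equiv.ofBijective _ (ofCoords_bijective hw)).symm).trans <|
    (Equiv.arrowProdEquivProdArrow R _ _).trans (Equiv.sumArrowEquivProdArrow R R (ZMod 2)).symm

theorem ofCoords_vecCoords {w : F4} (hw : w ^ 2 + w + 1 = 0) {R : Type} (g : R → F4) (r : R) :
    ofCoords w (vecCoords hw R g (Sum.inl r), vecCoords hw R g (Sum.inr r)) = g r :=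
  (Equiv.ofBijective _ (ofCoords_bijective hw)).apply_symm_apply (g r)

/-- In binary coordinates, `mulMap` is multiplication by `w`. -/
theorem vecCoords_smul {w : F4} (hw : w ^ 2 + w + 1 = 0) {R : Type} (g : R → F4) :
    vecCoords hw R (w • g) = mulMap R (vecCoords hw R g) := by
  have h : ∀ r, (vecCoords hw R (w • g) (Sum.inl r), vecCoords hw R (w • g) (Sum.inr r)) =
      (mulMap R (vecCoords hw R g) (Sum.inl r), mulMap R (vecCoords hw R g) (Sum.inr r)) :=
    fun r => (ofCoords_bijective hw).1 (by
      rw [ofCoords_vecCoords]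
      change w * g r = ofCoords w (vecCoords hw R g (Sum.inr r),
        vecCoords hw R g (Sum.inl r) + vecCoords hw R g (Sum.inr r))
      rw [← mul_ofCoords hw, ofCoords_vecCoords])
  funext r
  rcases r with r | r
  · exact congrArg Prod.fst (h r)
  · exact congrArg Prod.snd (h r)

theorem lineVec_mulMap {w : F4} (hw : w ^ 2 + w + 1 = 0) {R : Type} (g : R → F4) :
    lineVec w (vecCoords hw R g) (mulMap R (vecCoords hw R g)) = Sum.elim g (w • g) := by
  funext r
  rcases r with r | r
  · exact ofCoords_vecCoords hw g r
  · change ofCoords w (vecCoords hw R g (Sum.inr r),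
        vecCoords hw R g (Sum.inl r) + vecCoords hw R g (Sum.inr r)) = w * g r
    rw [← mul_ofCoords hw, ofCoords_vecCoords]

theorem vecCoords_zero {w : F4} (hw : w ^ 2 + w + 1 = 0) (R : Type) : vecCoords hw R 0 = 0 := by
  have h : ∀ r, (vecCoords hw R 0 (Sum.inl r), vecCoords hw R 0 (Sum.inr r)) = 0 := fun r =>
    (ofCoords_bijective hw).1 (by rw [ofCoords_vecCoords, map_zero]; rfl)
  funext r
  rcases r with r | r
  · exact congrArg Prod.fst (h r)
  · exact congrArg Prod.snd (h r)

theorem pow_three_eq_one {w : F4} (hw : w ^ 2 + w + 1 = 0) : w ^ 3 = 1 := by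
  linear_combination (w - 1) * hw

theorem eq_pow_of_ne_zero {w : F4} (hw : w ^ 2 + w + 1 = 0) {a : F4} (ha : a ≠ 0) :
    ∃ t : Fin 3, a = w ^ (t : ℕ) := by
  obtain ⟨⟨x, y⟩, rfl⟩ := (ofCoords_bijective hw).2 a
  have h2 : (2 : F4) = 0 := CharTwo.two_eq_zero
  have hxy : (x, y) = (0, 0) ∨ (x, y) = (1, 0) ∨ (x, y) = (0, 1) ∨ (x, y) = (1, 1) :=
    (by decide : ∀ x y : ZMod 2, (x, y) = (0, 0) ∨ (x, y) = (1, 0) ∨ (x, y) = (0, 1) ∨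
      (x, y) = (1, 1)) x y
  rcases hxy with h | h | h | h <;> rw [h] at ha ⊢
  · exact absurd (map_zero (ofCoords w)) ha
  · exact ⟨0, by simp [ofCoords_apply]⟩
  · exact ⟨1, by simp [ofCoords_apply]⟩
  · refine ⟨2, ?_⟩
    simp only [ofCoords_apply, map_one, mul_one, Fin.val_two]
    linear_combination (1 + w) * h2 - hw

theorem pow_injective {w : F4} (hw : w ^ 2 + w + 1 = 0) :
    Function.Injective fun t : Fin 3 => w ^ (t : ℕ) := by
  have h2 : (2 : F4) = 0 := CharTwo.two_eq_zero
  have hw1 : w ≠ 1 := by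
    rintro rfl
    refine one_ne_zero (α := F4) ?_
    linear_combination hw - h2
  have hw0 : w ≠ 0 := by
    rintro rfl
    simp at hw
  have hw2 : w ^ 2 ≠ 1 := fun h => hw0 (by linear_combination hw - h - h2)
  have hw3 : w ^ 2 ≠ w := fun h => hw1 (by
    have := mul_right_cancel₀ hw0 ((one_mul w).trans (h.symm.trans (sq w)))
    exact this.symm)
  intro a b hab
  fin_cases a <;> fin_cases b <;> simp_all [eq_comm]

theorem pow_mulMap_vecCoords {w : F4} (hw : w ^ 2 + w + 1 = 0) {R : Type} (t : ℕ) (g : R → F4) :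
    (mulMap R ^ t) (vecCoords hw R g) = vecCoords hw R (w ^ t • g) := by
  induction t with
  | zero => simp
  | succ t ih => rw [pow_succ', Module.End.mul_apply, ih, ← vecCoords_smul, smul_smul, ← pow_succ']

theorem map_val_eq_sum {α β : Type} (s : Finset α) (F : α → β) :
    s.val.map F = ∑ x ∈ s, {F x} := by
  rw [Finset.sum, ← Multiset.sum_map_singleton (s.val.map F), Multiset.map_map]
  rfl

/-- The nonzero vectors are the disjoint union of the images of the simplex points under the
powers of `mulMap`. -/
theorem sum_map_pow_mulMap {w : F4} (hw : w ^ 2 + w + 1 = 0) {R ι : Type} [Fintype R]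
    [DecidableEq R] [Fintype ι] {G : Matrix R ι F4} (hG : IsSimplexGenerator G) :
    ∑ t : Fin 3, (Finset.univ : Finset ι).val.map
        (fun i => (mulMap R ^ (t : ℕ)) (vecCoords hw R fun r => G r i)) =
      ((Finset.univ : Finset (R ⊕ R → ZMod 2)).erase 0).val := by
  have hw0 : w ≠ 0 := by
    rintro rfl
    simp at hw
  let F : ι × Fin 3 → (R ⊕ R → ZMod 2) :=
    fun p => vecCoords hw R (w ^ (p.2 : ℕ) • fun r => G r p.1)
  have hinj : Function.Injective F := by
    rintro ⟨i, a⟩ ⟨j, b⟩ h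
    have h1 : (w ^ (a : ℕ) • fun r => G r i) = w ^ (b : ℕ) • fun r => G r j :=
      (vecCoords hw R).injective h
    have hne : (w ^ (a : ℕ) • fun r => G r i) ≠ 0 :=
      smul_ne_zero (pow_ne_zero _ hw0) (hG.col_ne_zero i)
    obtain rfl : i = j := (hG.existsUnique _ hne).unique ⟨_, pow_ne_zero _ hw0, rfl⟩
      ⟨_, pow_ne_zero _ hw0, h1⟩
    rw [pow_injective hw (smul_left_injective F4 (hG.col_ne_zero i) h1)]
  have himage : Finset.univ.image F = Finset.univ.erase 0 := by
    ext v
    simp only [Finset.mem_image, Finset.mem_univ, true_and, Finset.mem_erase, and_true]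
    constructor
    · rintro ⟨⟨i, t⟩, rfl⟩ h
      rw [← vecCoords_zero hw R] at h
      exact smul_ne_zero (pow_ne_zero _ hw0) (hG.col_ne_zero i) ((vecCoords hw R).injective h)
    · intro hv
      obtain ⟨g, rfl⟩ := (vecCoords hw R).surjective v
      have hg : g ≠ 0 := by
        rintro rfl
        exact hv (vecCoords_zero hw R)
      obtain ⟨i, ⟨a, ha, rfl⟩, -⟩ := hG.existsUnique g hg
      obtain ⟨t, rfl⟩ := eq_pow_of_ne_zero hw ha
      exact ⟨(i, t), rfl⟩
  rw [← himage, Finset.image_val_of_injOn hinj.injOn]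
  simp only [pow_mulMap_vecCoords, map_val_eq_sum]
  exact (Fintype.sum_prod_type_right fun p => {F p}).symm

/-- The columns of the divided simplex matrix are the vectors `x + w T x` for the nonzero binary
vectors `x`, where `T` is multiplication by `w`. -/
theorem columns_dividedSimplex {w : F4} (hw : w ^ 2 + w + 1 = 0) {R ι : Type} [Fintype R]
    [DecidableEq R] [Fintype ι] {G : Matrix R ι F4} (hG : IsSimplexGenerator G) :
    columns (dividedSimplex w G) =
      (Finset.univ.erase 0).val.map fun x => lineVec w x (mulMap R x) := by
  have h3 := pow_three_eq_one hw
  rw [← sum_map_pow_mulMap hw hG, Fin.sum_univ_three, columns, ← Finset.univ_disjSum_univ,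
    ← Finset.univ_disjSum_univ]
  simp only [Finset.val_disjSum, Multiset.disjSum, Multiset.map_add, Multiset.map_map,
    pow_mulMap_vecCoords, Function.comp_def, lineVec_mulMap, ← add_assoc, smul_smul, ← pow_succ']
  congr 1
  · congr 1
    · refine Multiset.map_congr rfl fun j _ => funext fun r => ?_
      rcases r with r | r <;> simp [dividedSimplex]
    · refine Multiset.map_congr rfl fun j _ => funext fun r => ?_
      rcases r with r | r <;> simp [dividedSimplex]
  · refine Multiset.map_congr rfl fun j _ => funext fun r => ?_
    rcases r with r | r <;> simp [dividedSimplex, h3]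

/-! ### Codes of lines and the division into three parts -/

section LineCode

variable {R₁ R₂ : Type} {N : ℕ} (w : F4) (T₁ : (R₁ → ZMod 2) →ₗ[ZMod 2] (R₁ → ZMod 2))
  (T₂ : (R₂ → ZMod 2) →ₗ[ZMod 2] (R₂ → ZMod 2)) (y : Fin N → R₁ → ZMod 2)
  (z : Fin N → R₂ → ZMod 2)

/-- The matrix whose columns are the vectors `x + w T x` for the points `x = (y i, z i)`, where `T`
is the direct sum of `T₁` and `T₂`. -/
noncomputable def lineMatrix : Matrix (R₁ ⊕ R₂) (Fin N) F4 :=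
  fun r i => Sum.elim (lineVec w (y i) (T₁ (y i))) (lineVec w (z i) (T₂ (z i))) r

/-- Evaluation of a functional on the product at the two points `x` and `T x` spanning the line of
each column. -/
noncomputable def lineEval :
    (Module.Dual (ZMod 2) (R₁ → ZMod 2) × Module.Dual (ZMod 2) (R₂ → ZMod 2)) →ₗ[ZMod 2]
      (Fin N → F4) where
  toFun u i := ofCoords w (u.1 (y i) + u.2 (z i), u.1 (T₁ (y i)) + u.2 (T₂ (z i)))
  map_add' u v := by
    funext i
    rw [Pi.add_apply, ← map_add]
    congr 1
    ext <;> simp [add_add_add_comm]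
  map_smul' c u := by
    funext i
    rw [Pi.smul_apply, ← map_smul]
    congr 1
    ext <;> simp [mul_add]

theorem lineEval_apply (u : Module.Dual (ZMod 2) (R₁ → ZMod 2) × Module.Dual (ZMod 2) (R₂ → ZMod 2))
    (i : Fin N) : lineEval w T₁ T₂ y z u i =
      ofCoords w (u.1 (y i) + u.2 (z i), u.1 (T₁ (y i)) + u.2 (T₂ (z i))) := rfl

theorem dual_eq_sum_smul_proj {R : Type} [Fintype R] [DecidableEq R]
    (u : Module.Dual (ZMod 2) (R → ZMod 2)) :
    u = ∑ r, u (fun j => if r = j then 1 else 0) • LinearMap.proj r := by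
  refine LinearMap.ext fun x => ?_
  rw [LinearMap.pi_apply_eq_sum_univ u x, LinearMap.sum_apply]
  refine Finset.sum_congr rfl fun r _ => ?_
  simp [mul_comm]

theorem range_lineEval [Fintype R₁] [Fintype R₂] [DecidableEq R₁] [DecidableEq R₂] :
    (lineEval w T₁ T₂ y z).toAddMonoidHom.range = codeOf (lineMatrix w T₁ T₂ y z) := by
  have hl : ∀ r, lineEval w T₁ T₂ y z (LinearMap.proj r, 0) =
      lineMatrix w T₁ T₂ y z (Sum.inl r) := fun r => funext fun i => by
    simp [lineEval_apply, lineMatrix, lineVec]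
  have hr : ∀ r, lineEval w T₁ T₂ y z (0, LinearMap.proj r) =
      lineMatrix w T₁ T₂ y z (Sum.inr r) := fun r => funext fun i => by
    simp [lineEval_apply, lineMatrix, lineVec]
  apply le_antisymm
  · rintro _ ⟨⟨u₁, u₂⟩, rfl⟩
    let M : Submodule (ZMod 2) (Fin N → F4) :=
      AddSubgroup.toZModSubmodule 2 (codeOf (lineMatrix w T₁ T₂ y z))
    have hM : ∀ r, lineMatrix w T₁ T₂ y z r ∈ M := fun r => AddSubgroup.subset_closure ⟨r, rfl⟩
    change lineEval w T₁ T₂ y z (u₁, u₂) ∈ M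
    have hu : (u₁, u₂) = LinearMap.inl (ZMod 2) _ _ u₁ + LinearMap.inr (ZMod 2) _ _ u₂ := by simp
    rw [hu, map_add, dual_eq_sum_smul_proj u₁, dual_eq_sum_smul_proj u₂]
    simp only [map_sum, map_smul]
    refine M.add_mem (M.sum_mem fun r _ => M.smul_mem _ ?_) (M.sum_mem fun r _ => M.smul_mem _ ?_)
    · exact hl r ▸ hM _
    · exact hr r ▸ hM _
  · rw [codeOf, AddSubgroup.closure_le]
    rintro _ ⟨r | r, rfl⟩
    · exact ⟨_, hl r⟩
    · exact ⟨_, hr r⟩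

end LineCode

theorem mulMap_pow_three (R : Type) : mulMap R ^ 3 = 1 := by
  refine LinearMap.ext fun x => ?_
  have h2 : ∀ v : R ⊕ R → ZMod 2, v + v = 0 := fun v => funext fun r =>
    (by decide : ∀ a : ZMod 2, a + a = 0) _
  rw [pow_succ', pow_two, Module.End.mul_apply, Module.End.mul_apply, mulMap_mulMap (mulMap R x),
    mulMap_mulMap, add_left_comm, h2, add_zero, Module.End.one_apply]

theorem sum_comp_of_injective {V : Type} [DecidableEq V] {Y : Finset V} {f : V → V}
    (hf : Function.Injective f) (hY : ∀ y ∈ Y, f y ∈ Y) (F : V → ℕ) :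
    ∑ y ∈ Y, F (f y) = ∑ y ∈ Y, F y := by
  have : Y.image f = Y :=
    Finset.eq_of_subset_of_card_le (Finset.image_subset_iff.mpr hY)
      (Finset.card_image_of_injective Y hf).ge
  rw [← Finset.sum_image (f := F) hf.injOn, this]

/-- The lines `{x, T x, x + T x}` for `x = (y, z)` with `y ∈ Y` and `z` a simplex point partition
the points `(y, z)` with `y ∈ Y` and `z ≠ 0`. A line not contained in a hyperplane has exactly two
points outside it, so twice the weight of a codeword counts points off a hyperplane. -/
theorem two_mul_hammingNorm_lineEval {w : F4} (hw : w ^ 2 + w + 1 = 0) {R₁ R ι : Type}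
    [Fintype R₁] [DecidableEq R₁] [Fintype R] [DecidableEq R] [Fintype ι] {G : Matrix R ι F4}
    (hG : IsSimplexGenerator G) {T : (R₁ → ZMod 2) →ₗ[ZMod 2] (R₁ → ZMod 2)}
    (hT : IsOrthomorphism T) {Y : Finset (R₁ → ZMod 2)} (hY : ∀ y ∈ Y, T y ∈ Y)
    (hY' : ∀ y ∈ Y, y + T y ∈ Y) {N : ℕ} (e : Fin N ≃ Y × ι)
    (u : Module.Dual (ZMod 2) (R₁ → ZMod 2) × Module.Dual (ZMod 2) (R ⊕ R → ZMod 2)) :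
    2 * hammingNorm (lineEval w T (mulMap R) (fun i => (e i).1)
      (fun i => vecCoords hw R fun r => G r (e i).2) u) = offCount Y u := by
  have hinj : Function.Injective T := (injective_iff_map_eq_zero T).mpr hT.eq_zero_of_map
  have hinj' : Function.Injective fun y => y + T y :=
    (injective_iff_map_eq_zero (LinearMap.id + T)).mpr hT.eq_zero_of_add
  have key : ∀ a b : ZMod 2, 2 * (if (a, b) ≠ 0 then 1 else 0) =
      (if a ≠ 0 then 1 else 0) + (if b ≠ 0 then 1 else 0) + (if a + b ≠ 0 then 1 else 0) := by
    decide
  have hnz : ∀ F : (R ⊕ R → ZMod 2) → ℕ, ∑ v ∈ Finset.univ.erase 0, F v =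
      ∑ i, (F (vecCoords hw R fun r => G r i) + F (mulMap R (vecCoords hw R fun r => G r i)) +
        F ((vecCoords hw R fun r => G r i) + mulMap R (vecCoords hw R fun r => G r i))) := by
    intro F
    rw [Finset.sum, ← sum_map_pow_mulMap hw hG, Fin.sum_univ_three, Multiset.map_add,
      Multiset.map_add, Multiset.sum_add, Multiset.sum_add, Finset.sum_add_distrib,
      Finset.sum_add_distrib, Multiset.map_map, Multiset.map_map, Multiset.map_map]
    simp only [Fin.val_zero, Fin.val_one, Fin.val_two, pow_zero, pow_one, pow_two, ← mulMap_mulMap]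
    rfl
  have hne : ∀ a b : ZMod 2, ofCoords w (a, b) ≠ 0 ↔ (a, b) ≠ 0 := fun a b =>
    not_congr (map_eq_zero_iff _ (ofCoords_bijective hw).1)
  unfold offCount
  simp only [hnz]
  rw [Finset.sum_comm, hammingNorm, Finset.card_filter]
  simp only [lineEval_apply, hne]
  rw [Fintype.sum_equiv e _ (fun p : Y × ι =>
      if (u.1 p.1 + u.2 (vecCoords hw R fun r => G r p.2),
        u.1 (T p.1) + u.2 (mulMap R (vecCoords hw R fun r => G r p.2))) ≠ 0 then 1 else 0)
      fun i => rfl, Fintype.sum_prod_type_right, Finset.mul_sum]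
  refine Finset.sum_congr rfl fun i _ => ?_
  set v := vecCoords hw R fun r => G r i
  rw [Finset.mul_sum, Finset.sum_coe_sort Y (fun x => 2 * (if (u.1 x + u.2 v,
    u.1 (T x) + u.2 (mulMap R v)) ≠ 0 then 1 else 0))]
  simp only [key, Finset.sum_add_distrib]
  congr 1
  · congr 1
    exact sum_comp_of_injective hinj hY fun x => if u.1 x + u.2 (mulMap R v) ≠ 0 then 1 else 0
  · rw [← sum_comp_of_injective hinj' hY' fun x =>
      if u.1 x + u.2 (v + mulMap R v) ≠ 0 then 1 else 0]
    simp only [map_add, add_add_add_comm]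

/-- The division into three parts: `B j` uses the simplex points multiplied by `w ^ j`. As this
multiplication commutes with the map defining the lines, all three parts generate the same code. -/
theorem exists_three_parts {w : F4} (hw : w ^ 2 + w + 1 = 0) {R₁ R ι : Type}
    [Fintype R₁] [DecidableEq R₁] [Fintype R] [DecidableEq R] [Fintype ι] {G : Matrix R ι F4}
    (hG : IsSimplexGenerator G) {T : (R₁ → ZMod 2) →ₗ[ZMod 2] (R₁ → ZMod 2)}
    (hT : IsOrthomorphism T) {Y : Finset (R₁ → ZMod 2)} (hY : ∀ y ∈ Y, T y ∈ Y)
    (hY' : ∀ y ∈ Y, y + T y ∈ Y) {N : ℕ} (hN : Y.card * Fintype.card ι = N) :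
    ∃ (B : Fin 3 → Matrix (R₁ ⊕ (R ⊕ R)) (Fin N) F4)
      (ev : (Module.Dual (ZMod 2) (R₁ → ZMod 2) × Module.Dual (ZMod 2) (R ⊕ R → ZMod 2)) →+
        (Fin N → F4)),
      ∑ j, columns (B j) = (Y.val ×ˢ (Finset.univ.erase 0).val).map (fun p =>
        Sum.elim (lineVec w p.1 (T p.1)) (lineVec w p.2 (mulMap R p.2))) ∧
      (∀ j, ev.range = codeOf (B j)) ∧
      ∀ u, 2 * hammingNorm (ev u) = offCount Y u := by
  have e : Fin N ≃ Y × ι := (Fintype.equivFinOfCardEq (by simpa using hN)).symm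
  let y : Fin N → R₁ → ZMod 2 := fun i => (e i).1
  let ζ : ι → R ⊕ R → ZMod 2 := fun i => vecCoords hw R fun r => G r i
  let z : Fin 3 → Fin N → R ⊕ R → ZMod 2 := fun j i => (mulMap R ^ (j : ℕ)) (ζ (e i).2)
  have hcomm : ∀ (t : ℕ) (v : R ⊕ R → ZMod 2),
      mulMap R ((mulMap R ^ t) v) = (mulMap R ^ t) (mulMap R v) := fun t v => by
    rw [← Module.End.mul_apply, ← Module.End.mul_apply, ← pow_succ, ← pow_succ']
  refine ⟨fun j => lineMatrix w T (mulMap R) y (z j),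
    (lineEval w T (mulMap R) y (z 0)).toAddMonoidHom, ?_, fun j => ?_, fun u => ?_⟩
  · rw [← sum_map_pow_mulMap hw hG, Fin.sum_univ_three, Fin.sum_univ_three, Multiset.product_add,
      Multiset.product_add, Multiset.map_add, Multiset.map_add]
    have hcol : ∀ j, columns (lineMatrix w T (mulMap R) y (z j)) =
        (Y.val ×ˢ Finset.univ.val.map fun i => (mulMap R ^ (j : ℕ)) (ζ i)).map (fun p =>
          Sum.elim (lineVec w p.1 (T p.1)) (lineVec w p.2 (mulMap R p.2))) := by
      intro j
      have hYv : (Finset.univ : Finset Y).val.map Subtype.val = Y.val := by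
        rw [Finset.univ_eq_attach]
        exact Multiset.attach_map_val Y.val
      rw [← hYv, map_product_map, Multiset.map_map, ← Finset.product_val,
        Finset.univ_product_univ, ← Finset.map_univ_equiv e, Finset.map_val, Multiset.map_map]
      rfl
    rw [hcol, hcol, hcol]
  · rw [← range_lineEval]
    apply le_antisymm
    · rintro _ ⟨u, rfl⟩
      refine ⟨(u.1, u.2 ∘ₗ mulMap R ^ (2 * (j : ℕ))), funext fun i => ?_⟩
      have h1 : ∀ v, (mulMap R ^ (2 * (j : ℕ))) ((mulMap R ^ (j : ℕ)) v) = v := fun v => by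
        rw [← Module.End.mul_apply, ← pow_add, ← Nat.succ_mul, pow_mul, mulMap_pow_three, one_pow,
          Module.End.one_apply]
      change lineEval w T (mulMap R) y (z j) _ i = lineEval w T (mulMap R) y (z 0) u i
      simp only [lineEval_apply, LinearMap.comp_apply, z, hcomm, h1]
      rfl
    · rintro _ ⟨u, rfl⟩
      refine ⟨(u.1, u.2 ∘ₗ mulMap R ^ (j : ℕ)), funext fun i => ?_⟩
      change lineEval w T (mulMap R) y (z 0) _ i = lineEval w T (mulMap R) y (z j) u i
      simp only [lineEval_apply, LinearMap.comp_apply, z, hcomm]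
      rfl
  · exact two_mul_hammingNorm_lineEval hw hG hT hY hY' e u

/-! ### Parameters of the codes -/

theorem card_dual (R : Type) [Fintype R] [DecidableEq R]
    [Fintype (Module.Dual (ZMod 2) (R → ZMod 2))] :
    Fintype.card (Module.Dual (ZMod 2) (R → ZMod 2)) = 2 ^ Fintype.card R := by
  rw [Module.card_eq_pow_finrank (K := ZMod 2), Subspace.dual_finrank_eq, Module.finrank_pi,
    ZMod.card]

theorem isGPO_and_isGriesmerCode {w : F4} (hw : w ^ 2 + w + 1 = 0) {n k d : ℕ}
    {C : AddSubgroup (Fin n → F4)} (hC : IsAdditiveCode n k d C) (hk : 3 ≤ k) (hd : 2 ∣ d)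
    (hn : 3 * n = griesmerSum k (2 * d)) : IsGPO n k d C ∧ IsGriesmerCode n k d C := by
  have h4 : griesmerSum k (2 * d) + 4 ≤ griesmerSum k (2 * d + 2) :=
    griesmerSum_add_four_le hk (by omega)
  refine ⟨⟨hC, by omega, ?_⟩, hC, hn⟩
  rintro ⟨d', D, hd', hD⟩
  have h1 := griesmerSum_le_of_isAdditiveCode hw hD
  have h2 := griesmerSum_mono k (show 2 * d + 2 ≤ 2 * d' by omega)
  omega

/-- The parameters of a code whose weights are those of `pairWeight a b c`. -/
theorem code_of_pairWeight {D₁ D₂ : Type} [AddCommGroup D₁] [AddCommGroup D₂] [Fintype D₁]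
    [Fintype D₂] [DecidableEq D₁] [DecidableEq D₂] {k k₁ k₂ : ℕ}
    (hk₁ : 0 < k₁) (hk₂ : 0 < k₂) (h₁ : Fintype.card D₁ = 2 ^ k₁)
    (h₂ : Fintype.card D₂ = 2 ^ k₂) (hk : k = k₁ + k₂)
    {n a b c : ℕ} {C : AddSubgroup (Fin n → F4)} {ev : D₁ × D₂ →+ (Fin n → F4)}
    (hC : ev.range = C) (hev : ∀ u, hammingNorm (ev u) = pairWeight a b c u) (ha : 0 < a)
    (hab : a ≤ b) (hac : a ≤ c) :
    IsAdditiveCode n k a C ∧ IsTWeight ({a, b, c} : Finset ℕ).card C ∧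
      weightDistribution C = 1 + (2 ^ k₁ - 1) * (2 ^ k₂ - 1) * X ^ a
        + (2 ^ k₁ - 1) * X ^ b + (2 ^ k₂ - 1) * X ^ c := by
  have : Nontrivial D₁ := Fintype.one_lt_card_iff_nontrivial.mp (h₁ ▸ Nat.one_lt_two_pow hk₁.ne')
  have : Nontrivial D₂ := Fintype.one_lt_card_iff_nontrivial.mp (h₂ ▸ Nat.one_lt_two_pow hk₂.ne')
  have hmin : ∀ u, u ≠ 0 → a ≤ hammingNorm (ev u) := by
    rintro ⟨u₁, u₂⟩ hu
    rw [hev, pairWeight]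
    split_ifs with h h' h'
    · exact absurd (Prod.ext h h') hu
    all_goals omega
  have hinj := injective_of_hammingNorm_ne_zero fun u hu => (ha.trans_le (hmin u hu)).ne'
  refine ⟨isAdditiveCode_of_param hC hinj ?_ ?_ hmin, isTWeight_of_image hC hinj ?_, ?_⟩
  · rw [Fintype.card_prod, h₁, h₂, hk, pow_add]
  · obtain ⟨x, hx⟩ := exists_ne (0 : D₁)
    obtain ⟨y, hy⟩ := exists_ne (0 : D₂)
    exact ⟨(x, y), by simp [hx], by simp [hev, pairWeight, hx, hy]⟩
  · simp only [hev, image_pairWeight]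
  · rw [weightDistribution_eq_sum hC hinj]
    simp only [hev, sum_X_pow_pairWeight, h₁, h₂]
    push_cast
    rfl

theorem equivalent_of_eq {n : ℕ} {C D : AddSubgroup (Fin n → F4)} (h : C = D) : Equivalent C D :=
  ⟨Equiv.refl _, fun c => by rw [h]; rfl⟩

theorem msDiff_add_right {V : Type} (L M : Multiset V) : msDiff (L + M) M = L :=
  let _ := Classical.decEq V
  add_tsub_cancel_right L M

theorem card_triple {a b c : ℕ} (hab : a ≠ b) (hac : a ≠ c) (hbc : b ≠ c) :
    ({a, b, c} : Finset ℕ).card = 3 :=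
  Finset.card_eq_three.mpr ⟨a, b, c, hab, hac, hbc, rfl⟩

theorem three_mul_card_simplex (l : ℕ) : 3 * ((4 ^ l - 1) / 3) + 1 = 2 ^ (2 * l) := by
  have h : 3 ∣ 4 ^ l - 1 := by simpa using Nat.sub_dvd_pow_sub_pow 4 1 l
  rw [pow_mul, show (2 : ℕ) ^ 2 = 4 from rfl]
  have := Nat.one_le_pow l 4 (by norm_num)
  omega

theorem exists_two_pow_eq {k : ℕ} (h : 2 ≤ k) :
    ∃ p, 2 ^ (k - 2) = p ∧ 2 ^ (k - 1) = 2 * p ∧ 2 ^ k = 4 * p := by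
  obtain ⟨m, rfl⟩ := Nat.exists_eq_add_of_le' h
  refine ⟨2 ^ m, rfl, ?_, ?_⟩
  · exact pow_succ' 2 m
  · exact (pow_add 2 m 2).trans (mul_comm _ _)

/-- The part of the generator multiset off the subspace `z = 0`: the weight of a nonzero codeword is
`2 ^ (k - 2)` if its functional vanishes on the first summand, and `2 ^ (k₁ - 2)` less otherwise. -/
theorem code_of_offCount_univ {k k₁ k₂ : ℕ} (h3 : 3 ≤ k₁) (h3' : 3 ≤ k₂) (hk : k = k₁ + k₂)
    {w : F4} (hw : w ^ 2 + w + 1 = 0) {R₁ R₂ : Type} [Fintype R₁] [DecidableEq R₁] [Fintype R₂]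
    [DecidableEq R₂] (hr₁ : Fintype.card R₁ = k₁) (hr₂ : Fintype.card R₂ = k₂)
    {n : ℕ} (hn : 3 * n = 2 ^ k - 2 ^ k₁)
    {C : AddSubgroup (Fin n → F4)}
    {ev : (Module.Dual (ZMod 2) (R₁ → ZMod 2) × Module.Dual (ZMod 2) (R₂ → ZMod 2)) →+
      (Fin n → F4)} (hev : ev.range = C)
    (hwt : ∀ u, 2 * hammingNorm (ev u) = offCount Finset.univ u) :
    IsAdditiveCode n k (2 ^ (k - 2) - 2 ^ (k₁ - 2)) C ∧ IsTWeight 2 C ∧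
      weightDistribution C = 1 + (2 ^ k - 2 ^ k₂) * X ^ (2 ^ (k - 2) - 2 ^ (k₁ - 2))
        + (2 ^ k₂ - 1) * X ^ (2 ^ (k - 2)) ∧
      IsGPO n k (2 ^ (k - 2) - 2 ^ (k₁ - 2)) C ∧
      IsGriesmerCode n k (2 ^ (k - 2) - 2 ^ (k₁ - 2)) C := by
  classical
  have := Module.finite_of_finite (M := Module.Dual (ZMod 2) (R₁ → ZMod 2)) (ZMod 2)
  have := Module.finite_of_finite (M := Module.Dual (ZMod 2) (R₂ → ZMod 2)) (ZMod 2)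
  have := Fintype.ofFinite (Module.Dual (ZMod 2) (R₁ → ZMod 2))
  have := Fintype.ofFinite (Module.Dual (ZMod 2) (R₂ → ZMod 2))
  have hd₁ := card_dual R₁
  have hd₂ := card_dual R₂
  rw [hr₁] at hd₁
  rw [hr₂] at hd₂
  have hv₁ : Fintype.card (R₁ → ZMod 2) = 2 ^ k₁ := by rw [Fintype.card_fun, ZMod.card, hr₁]
  have hv₂ : Fintype.card (R₂ → ZMod 2) = 2 ^ k₂ := by rw [Fintype.card_fun, ZMod.card, hr₂]
  have hpq : 2 ^ k₁ * 2 ^ k₂ = 2 ^ k := by rw [hk, pow_add]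
  have hkX : (2 : ℤ[X]) ^ k = 2 ^ k₁ * 2 ^ k₂ := by rw [hk, pow_add]
  -- the parameters are polynomials in `p₁`, `p₂` and `q = 4 p₁ p₂`, linear apart from this relation
  obtain ⟨p₁, hp₁, e₁', e₁⟩ := exists_two_pow_eq (show 2 ≤ k₁ by omega)
  obtain ⟨p₂, hp₂, -, e₂⟩ := exists_two_pow_eq (show 2 ≤ k₂ by omega)
  obtain ⟨q, hq, e', e⟩ := exists_two_pow_eq (show 2 ≤ k by omega)
  have hp₁2 : 2 ∣ p₁ := hp₁ ▸ dvd_pow_self 2 (by omega)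
  have hq2 : 2 ∣ q := hq ▸ dvd_pow_self 2 (by omega)
  have hp₁0 : 0 < p₁ := hp₁ ▸ by positivity
  have hp₂0 : 0 < p₂ := hp₂ ▸ by positivity
  have eq12 : q = 4 * (p₁ * p₂) := by
    rw [e₁, e₂, e] at hpq
    linarith
  have hle₁ : p₁ ≤ p₁ * p₂ := Nat.le_mul_of_pos_right _ hp₂0
  have hle₂ : p₂ ≤ p₁ * p₂ := Nat.le_mul_of_pos_left _ hp₁0
  rw [hp₁, hq]
  have hpw : ∀ u, hammingNorm (ev u) = pairWeight (q - p₁) (q - p₁) q u := by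
    intro u
    have h := two_mul_offCount_univ u
    rw [← hwt, hv₁, hv₂, hpq] at h
    unfold pairWeight
    split_ifs at h ⊢ <;> first | omega | simp_all
  obtain ⟨hC, ht, hW⟩ := code_of_pairWeight (by omega) (by omega) hd₁ hd₂ hk hev hpw
    (by omega) le_rfl (by omega)
  have hGr : 3 * n = griesmerSum k (2 * (q - p₁)) := by
    have h := griesmerSum_two_pow_sub_two_pow (show k₁ - 1 ≤ k - 1 by omega)
    rw [Nat.sub_add_cancel (by omega), Nat.sub_add_cancel (by omega), e', e₁', ← Nat.mul_sub] at h
    omega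
  obtain ⟨hgpo, hgri⟩ := isGPO_and_isGriesmerCode hw hC (by omega) (by omega) hGr
  refine ⟨hC, ?_, ?_, hgpo, hgri⟩
  · rwa [Finset.insert_eq_of_mem (Finset.mem_insert_self _ _), Finset.card_pair (by omega)] at ht
  · rw [hW, hkX]
    ring

/-- The part of the generator multiset off the subspaces `y = 0` and `z = 0`: the weight of a
nonzero codeword drops from `2 ^ (k - 2)` by `2 ^ (k₁ - 2)` or `2 ^ (k₂ - 2)` for each summand
on which its functional does not vanish. -/
theorem code_of_offCount_erase {k k₁ k₂ : ℕ} (h3 : 3 ≤ k₁) (h3' : 3 ≤ k₂) (hne : k₁ ≠ k₂)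
    (hk : k = k₁ + k₂)
    {w : F4} (hw : w ^ 2 + w + 1 = 0) {R₁ R₂ : Type} [Fintype R₁] [DecidableEq R₁] [Fintype R₂]
    [DecidableEq R₂] (hr₁ : Fintype.card R₁ = k₁) (hr₂ : Fintype.card R₂ = k₂)
    {n : ℕ} (hn : 3 * n = 2 ^ k - 2 ^ k₁ - 2 ^ k₂ + 1)
    {C : AddSubgroup (Fin n → F4)}
    {ev : (Module.Dual (ZMod 2) (R₁ → ZMod 2) × Module.Dual (ZMod 2) (R₂ → ZMod 2)) →+
      (Fin n → F4)} (hev : ev.range = C)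
    (hwt : ∀ u, 2 * hammingNorm (ev u) = offCount (Finset.univ.erase 0) u) :
    IsAdditiveCode n k (2 ^ (k - 2) - 2 ^ (k₁ - 2) - 2 ^ (k₂ - 2)) C ∧ IsTWeight 3 C ∧
      weightDistribution C =
        1 + (2 ^ k - 2 ^ k₁ - 2 ^ k₂ + 1) * X ^ (2 ^ (k - 2) - 2 ^ (k₁ - 2) - 2 ^ (k₂ - 2))
        + (2 ^ k₁ - 1) * X ^ (2 ^ (k - 2) - 2 ^ (k₁ - 2))
        + (2 ^ k₂ - 1) * X ^ (2 ^ (k - 2) - 2 ^ (k₂ - 2)) ∧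
      IsGPO n k (2 ^ (k - 2) - 2 ^ (k₁ - 2) - 2 ^ (k₂ - 2)) C ∧
      IsGriesmerCode n k (2 ^ (k - 2) - 2 ^ (k₁ - 2) - 2 ^ (k₂ - 2)) C := by
  classical
  have := Module.finite_of_finite (M := Module.Dual (ZMod 2) (R₁ → ZMod 2)) (ZMod 2)
  have := Module.finite_of_finite (M := Module.Dual (ZMod 2) (R₂ → ZMod 2)) (ZMod 2)
  have := Fintype.ofFinite (Module.Dual (ZMod 2) (R₁ → ZMod 2))
  have := Fintype.ofFinite (Module.Dual (ZMod 2) (R₂ → ZMod 2))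
  have hd₁ := card_dual R₁
  have hd₂ := card_dual R₂
  rw [hr₁] at hd₁
  rw [hr₂] at hd₂
  have hv₁ : Fintype.card (R₁ → ZMod 2) = 2 ^ k₁ := by rw [Fintype.card_fun, ZMod.card, hr₁]
  have hv₂ : Fintype.card (R₂ → ZMod 2) = 2 ^ k₂ := by rw [Fintype.card_fun, ZMod.card, hr₂]
  have hpq : 2 ^ k₁ * 2 ^ k₂ = 2 ^ k := by rw [hk, pow_add]
  have hkX : (2 : ℤ[X]) ^ k = 2 ^ k₁ * 2 ^ k₂ := by rw [hk, pow_add]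
  -- the parameters are polynomials in `p₁`, `p₂` and `q = 4 p₁ p₂`, linear apart from this relation
  obtain ⟨p₁, hp₁, e₁', e₁⟩ := exists_two_pow_eq (show 2 ≤ k₁ by omega)
  obtain ⟨p₂, hp₂, e₂', e₂⟩ := exists_two_pow_eq (show 2 ≤ k₂ by omega)
  obtain ⟨q, hq, e', e⟩ := exists_two_pow_eq (show 2 ≤ k by omega)
  have hp₁2 : 2 ∣ p₁ := hp₁ ▸ dvd_pow_self 2 (by omega)
  have hp₂2 : 2 ∣ p₂ := hp₂ ▸ dvd_pow_self 2 (by omega)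
  have hq2 : 2 ∣ q := hq ▸ dvd_pow_self 2 (by omega)
  have hp₁0 : 0 < p₁ := hp₁ ▸ by positivity
  have hp₂0 : 0 < p₂ := hp₂ ▸ by positivity
  have eq12 : q = 4 * (p₁ * p₂) := by
    rw [e₁, e₂, e] at hpq
    linarith
  have hle₁ : p₁ ≤ p₁ * p₂ := Nat.le_mul_of_pos_right _ hp₂0
  have hle₂ : p₂ ≤ p₁ * p₂ := Nat.le_mul_of_pos_left _ hp₁0
  rw [hp₁, hp₂, hq]
  have hp12 : p₁ ≠ p₂ := fun h => by
    have := Nat.pow_right_injective le_rfl (hp₁.trans (h.trans hp₂.symm))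
    omega
  have hpw : ∀ u, hammingNorm (ev u) = pairWeight (q - p₁ - p₂) (q - p₁) (q - p₂) u := by
    intro u
    have h := two_mul_offCount_erase u
    rw [← hwt, hv₁, hv₂, hpq] at h
    unfold pairWeight
    split_ifs at h ⊢ <;> first | omega | simp_all
  obtain ⟨hC, ht, hW⟩ := code_of_pairWeight (by omega) (by omega) hd₁ hd₂ hk hev hpw
    (by omega) (by omega) (by omega)
  have hGr : 3 * n = griesmerSum k (2 * (q - p₁ - p₂)) := by
    have h := griesmerSum_two_pow_sub_sub (show k₁ - 1 ≠ k₂ - 1 by omega)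
      (show k₁ - 1 < k - 1 by omega) (show k₂ - 1 < k - 1 by omega)
    rw [Nat.sub_add_cancel (by omega), Nat.sub_add_cancel (by omega),
      Nat.sub_add_cancel (by omega), e', e₁', e₂', ← Nat.mul_sub, ← Nat.mul_sub] at h
    omega
  obtain ⟨hgpo, hgri⟩ := isGPO_and_isGriesmerCode hw hC (by omega) (by omega) hGr
  refine ⟨hC, ?_, ?_, hgpo, hgri⟩
  · rwa [card_triple (by omega) (by omega) (by omega)] at ht
  · rw [hW, hkX]
    ring

/-! ### The two families of codes -/

theorem mainTheorem5 (s l k₁ k₂ k : ℕ)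
    (hk₁ : k₁ = 2 * s + 3) (hl : 2 ≤ l) (hk₂ : k₂ = 2 * l) (hk : k = k₁ + k₂)
    (w : F4) (hw : w ^ 2 + w + 1 = 0)
    (f : Polynomial (ZMod 2)) (hf : f.Monic) (hf_irr : Irreducible f) (hf_deg : f.natDegree = 3)
    (S : Matrix (Fin 3) (Fin 7) (ZMod 2)) (hS : IsSimplexGenerator S)
    (G : Matrix (Fin l) (Fin ((4 ^ l - 1) / 3)) F4) (hG : IsSimplexGenerator G)
    (A₁ : Matrix (IterRows s) (IterCols s) F4) (hA₁ : A₁ = iterMatrix w (apsMatrix w f S) s)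
    (A₂ : Matrix (Fin l ⊕ Fin l) (Fin ((4 ^ l - 1) / 3) ⊕
      (Fin ((4 ^ l - 1) / 3) ⊕ Fin ((4 ^ l - 1) / 3))) F4) (hA₂ : A₂ = dividedSimplex w G)
    (L L₁ L₂ : Multiset (IterRows s ⊕ (Fin l ⊕ Fin l) → F4))
    (hL : L = columns (combine A₁ A₂))
    (hL₁ : L₁ = columns (padBelow (Fin l ⊕ Fin l) A₁))
    (hL₂ : L₂ = columns (padAbove (IterRows s) A₂)) :
    (∃ B : Fin 3 → Matrix (IterRows s ⊕ (Fin l ⊕ Fin l)) (Fin ((2 ^ k - 2 ^ k₁) / 3)) F4,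
      ∑ j, columns (B j) = msDiff L L₁ ∧
      (∀ i j, Equivalent (codeOf (B i)) (codeOf (B j))) ∧
      ∀ j,
        IsAdditiveCode ((2 ^ k - 2 ^ k₁) / 3) k (2 ^ (k - 2) - 2 ^ (k₁ - 2)) (codeOf (B j)) ∧
        IsTWeight 2 (codeOf (B j)) ∧
        weightDistribution (codeOf (B j)) =
          1 + (2 ^ k - 2 ^ k₂) * Polynomial.X ^ (2 ^ (k - 2) - 2 ^ (k₁ - 2))
            + (2 ^ k₂ - 1) * Polynomial.X ^ (2 ^ (k - 2)) ∧
        IsGPO ((2 ^ k - 2 ^ k₁) / 3) k (2 ^ (k - 2) - 2 ^ (k₁ - 2)) (codeOf (B j)) ∧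
        IsGriesmerCode ((2 ^ k - 2 ^ k₁) / 3) k (2 ^ (k - 2) - 2 ^ (k₁ - 2)) (codeOf (B j))) ∧
    (∃ B : Fin 3 → Matrix (IterRows s ⊕ (Fin l ⊕ Fin l))
        (Fin ((2 ^ k - 2 ^ k₁ - 2 ^ k₂ + 1) / 3)) F4,
      ∑ j, columns (B j) = msDiff L (L₁ + L₂) ∧
      (∀ i j, Equivalent (codeOf (B i)) (codeOf (B j))) ∧
      ∀ j,
        IsAdditiveCode ((2 ^ k - 2 ^ k₁ - 2 ^ k₂ + 1) / 3) k
          (2 ^ (k - 2) - 2 ^ (k₁ - 2) - 2 ^ (k₂ - 2)) (codeOf (B j)) ∧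
        IsTWeight 3 (codeOf (B j)) ∧
        weightDistribution (codeOf (B j)) =
          1 + (2 ^ k - 2 ^ k₁ - 2 ^ k₂ + 1)
              * Polynomial.X ^ (2 ^ (k - 2) - 2 ^ (k₁ - 2) - 2 ^ (k₂ - 2))
            + (2 ^ k₁ - 1) * Polynomial.X ^ (2 ^ (k - 2) - 2 ^ (k₁ - 2))
            + (2 ^ k₂ - 1) * Polynomial.X ^ (2 ^ (k - 2) - 2 ^ (k₂ - 2)) ∧
        IsGPO ((2 ^ k - 2 ^ k₁ - 2 ^ k₂ + 1) / 3) k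
          (2 ^ (k - 2) - 2 ^ (k₁ - 2) - 2 ^ (k₂ - 2)) (codeOf (B j)) ∧
        IsGriesmerCode ((2 ^ k - 2 ^ k₁ - 2 ^ k₂ + 1) / 3) k
          (2 ^ (k - 2) - 2 ^ (k₁ - 2) - 2 ^ (k₂ - 2)) (codeOf (B j))) := by
  classical
  obtain ⟨T, hT, hcol₁⟩ := exists_isOrthomorphism_iterMatrix hw hf hf_irr hf_deg hS s
  have hcol₂ := columns_dividedSimplex hw hG
  rw [← hA₁] at hcol₁
  rw [← hA₂] at hcol₂
  have hr₁ : Fintype.card (IterRows s) = k₁ := by rw [card_iterRows, hk₁]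
  have hr₂ : Fintype.card (Fin l ⊕ Fin l) = k₂ := by
    rw [Fintype.card_sum, Fintype.card_fin, hk₂, two_mul]
  have hv₁ : (Finset.univ : Finset (IterRows s → ZMod 2)).card = 2 ^ k₁ := by
    rw [Finset.card_univ, Fintype.card_fun, ZMod.card, hr₁]
  have hm := three_mul_card_simplex l
  rw [← hk₂] at hm
  have hkm : 2 ^ k = 3 * (2 ^ k₁ * ((4 ^ l - 1) / 3)) + 2 ^ k₁ := by
    rw [hk, pow_add, ← hm]
    ring
  have hle : 2 * ((4 ^ l - 1) / 3) ≤ 2 ^ k₁ * ((4 ^ l - 1) / 3) :=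
    Nat.mul_le_mul_right _ (Nat.one_lt_two_pow (by omega))
  -- the generator multiset, split into the star product and the two padded blocks
  let col : (IterRows s → ZMod 2) × (Fin l ⊕ Fin l → ZMod 2) →
      (IterRows s ⊕ (Fin l ⊕ Fin l) → F4) :=
    fun p => Sum.elim (lineVec w p.1 (T p.1)) (lineVec w p.2 (mulMap (Fin l) p.2))
  let P := ((Finset.univ.erase (0 : IterRows s → ZMod 2)).val ×ˢ
    (Finset.univ.erase (0 : Fin l ⊕ Fin l → ZMod 2)).val).map col
  have hLP : L = P + (L₁ + L₂) := by
    rw [hL, hL₁, hL₂, columns_combine, hcol₁, hcol₂, map_product_map, Multiset.map_map]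
    rfl
  have hPL₂ : (Finset.univ.val ×ˢ (Finset.univ.erase (0 : Fin l ⊕ Fin l → ZMod 2)).val).map col =
      P + L₂ := by
    rw [← Multiset.cons_erase (Finset.mem_univ_val (0 : IterRows s → ZMod 2)),
      Multiset.cons_product, Multiset.map_add, add_comm, hL₂, columns_padAbove, hcol₂,
      Multiset.map_map, Multiset.map_map, ← Finset.erase_val]
    congr 1
    refine Multiset.map_congr rfl fun v _ => ?_
    simp only [Function.comp_apply, col, map_zero, lineVec_zero]
  constructor
  · have hN : 2 ^ k₁ * ((4 ^ l - 1) / 3) = (2 ^ k - 2 ^ k₁) / 3 := by omega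
    obtain ⟨B, ev, hB, hev, hwt⟩ := exists_three_parts hw hG hT (Y := Finset.univ)
      (fun _ _ => Finset.mem_univ _) (fun _ _ => Finset.mem_univ _)
      (by rw [hv₁, Fintype.card_fin, hN])
    refine ⟨B, ?_, fun i j => equivalent_of_eq ((hev i).symm.trans (hev j)), fun j =>
      code_of_offCount_univ (by omega) (by omega) hk hw hr₁ hr₂ (by omega) (hev j) hwt⟩
    -- removing the first padded block leaves the points `(y, z)` with `z ≠ 0` and `y` arbitrary
    rw [hB, hLP, add_comm L₁, ← add_assoc, msDiff_add_right]
    exact hPL₂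
  · have hN : (2 ^ k₁ - 1) * ((4 ^ l - 1) / 3) = (2 ^ k - 2 ^ k₁ - 2 ^ k₂ + 1) / 3 := by
      have := Nat.one_lt_two_pow (show k₂ ≠ 0 by omega)
      rw [Nat.sub_mul, one_mul]
      omega
    have hmem : ∀ x : IterRows s → ZMod 2, x ∈ Finset.univ.erase 0 ↔ x ≠ 0 := fun x => by simp
    obtain ⟨B, ev, hB, hev, hwt⟩ := exists_three_parts hw hG hT (Y := Finset.univ.erase 0)
      (fun x hx => (hmem _).2 fun h => (hmem x).1 hx (hT.eq_zero_of_map x h))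
      (fun x hx => (hmem _).2 fun h => (hmem x).1 hx (hT.eq_zero_of_add x h))
      (by rw [Finset.card_erase_of_mem (Finset.mem_univ _), hv₁, Fintype.card_fin, hN])
    refine ⟨B, ?_, fun i j => equivalent_of_eq ((hev i).symm.trans (hev j)), fun j =>
      code_of_offCount_erase (by omega) (by omega) (by omega) hk hw hr₁ hr₂ ?_ (hev j) hwt⟩
    · rw [hB, hLP, msDiff_add_right]
    · have := Nat.one_lt_two_pow (show k₂ ≠ 0 by omega)
      have := Nat.one_lt_two_pow (show k₁ ≠ 0 by omega)
      rw [← hN, Nat.sub_mul, one_mul]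
      omega
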